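/- **Setting.** Let $(\Omega,\mathcal F,\mathbb P)$ be a probability space and $W(k)\in L^2(\Omega;\mathbb R^m)$, $k\in\mathbb N_0$, an i.i.d. sequence with mean $\mu_W$. Let $A\in\mathbb R^{n\times n}$, $B\in\mathbb R^{n\times l}$ with $(A,B)$ stabilizable, $E\in\mathbb R^{n\times m}$, $z\in\mathbb R^n$, and $f(x,u,w)=Ax+Bu+Ew+z$. Let $Q_1,Q_2\in\mathbb R^{n\times n}$ and $R_1,R_2\in\mathbb R^{l\times l}$ be symmetric with $Q_1,Q_2,R_2\ge 0$, $R_1>0$, let $s\in\mathbb R^n$, $v\in\mathbb R^l$, $c\in\mathbb R$, and put $$\ell(X,U)=\mathbb E[X^TQ_1X+U^TR_1U+s^TX+v^TU+c]+\mathrm{Tr}(Q_2\,\mathrm{Cov}(X))+\mathrm{Tr}(R_2\,\mathrm{Cov}(U)).$$ For $X_0\in L^2(\Omega;\mathbb R^n)$ and a control process $U(\cdot)$, let $X_U(\cdot,X_0)$ be the solution of $X(k+1)=f(X(k),U(k),W(k))$, $X(0)=X_0$. The control is *admissible* on the horizon $N$ if for all $k<N$ the random vector $U(k)$ is square integrable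 and (up to null sets) $\sigma(X(0),\dots,X(k))$-measurable, and $W(k)$ is independent of $X(k)$ and of $U(k)$. Put $J_N(X_0,U)=\sum_{k=0}^{N-1}\ell(X_U(k,X_0),U(k))$. Let $\mathcal P_2$ denote the probability measures with finite second moment, $\mathcal K_\infty$ the continuous, strictly increasing, unbounded functions $\alpha:[0,\infty)\to[0,\infty)$ with $\alpha(0)=0$, and $\|x\|_M^2=x^TMx$. **Theorem.** Assume that $(x^s,u^s)$ solves $(I-A)x^s-Bu^s=E\mu_W+z$ and that $(A,Q_1^{1/2})$ is detectable. Then there are a positive semidefinite solution $P$ of the Riccati equation $$P=A^TPA+Q_1+Q_2-A^TPB[R_1+R_2+B^TPB]^{-1}B^TPA,$$ a positive definite $S\in\mathbb R^{n\times n}$, $q\in\mathbb R^n$, a solution $(\tilde x,\tilde u)$ of $(I-A)\tilde x-B\tilde u=0$, a function $\alpha\in\mathcal K_\infty$ and, with $K=-[R_1+R_2+B^TPB]^{-1}B^TPA$ and $\pi(x)=K(x-\tilde x-x^s)+\tilde u+u^s$, a distribution $\varrho\in\mathcal P_2(\mathbb R^n)$ invariant for the closed loop $x\mapsto f(x,\pi(x),w)$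 with noise distributed as $W(0)$, such that the following holds. Let $X^s_{\star}(0)\sim\varrho$ be any initial value for which the process $X^s_\star(k+1)=f(X^s_\star(k),U^s_\star(k),W(k))$, $U^s_\star(k)=\pi(X^s_\star(k))$, has $X^s_\star(k)$ independent of $W(k)$ for all $k$. (Such an initial value exists whenever $\Omega$ carries, for every distribution in $\mathcal P_2(\mathbb R^n)$, a random vector with that distribution independent of the noise sequence $(W(k))_{k\ge0}$.) Then: 1. $(X^s_\star,U^s_\star)$ is a stationary pair: for all $k$, $X^s_\star(k)$ has one and the same distribution in $\mathcal P_2(\mathbb R^n)$, $U^s_\star(k)$ has one and the same distribution in $\mathcal P_2(\mathbb R^l)$, $U^s_\star(k)$ is $\sigma(X^s_\star(0),\dots,X^s_\star(k))$-measurable, and $W(k)$ is independent of $X^s_\star(k)$ and of $U^s_\star(k)$. 2. The problem is strictly dissipative in $L^2$ at this pair with comparison function $\alpha$ and storage function $$\lambda(k,X)=\mathbb E\big[\|X-(X^s_\star(k)-\tilde x)\|_{P+S}^2-\|X-x^s\|_P^2+q^T(X-(X^s_\star(k)-\tilde x))\big],$$ i.e. $\lambda$ is bounded from below on $\mathbb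 N_0\times L^2$ and, for all $k$ and all square integrable $X,U$ each independent of $W(k)$, $$\ell(X,U)-\ell(X^s_\star(k),U^s_\star(k))+\lambda(k,X)-\lambda(k+1,f(X,U,W(k)))\ge\alpha\big(\mathbb E\|X-X^s_\star(k)\|^2\big).$$ 3. (Mean-square turnpike property.) For every $X_0\in L^2(\Omega;\mathbb R^n)$ there is a constant $C\in\mathbb R$ such that for all $N\in\mathbb N_0$, all $\delta>0$, all controls $U(\cdot)$ admissible on the horizon $N$ with $J_N(X_0,U)\le\delta+\sum_{k=0}^{N-1}\ell(X^s_\star(k),U^s_\star(k))$ and all $\varepsilon>0$, $$\#\big\{k\in\{0,\dots,N-1\}:\ \mathbb E\big[\|X_U(k,X_0)-X^s_\star(k)\|^2\big]\le\varepsilon\big\}\ \ge\ N-\frac{\delta+C}{\alpha(\varepsilon)} .$$ -/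

import Mathlib

open MeasureTheory ProbabilityTheory Filter
open scoped Matrix MatrixOrder

noncomputable section

/-- A real square matrix is Schur stable if all its complex eigenvalues have modulus `< 1`. -/
def IsSchur {n : ℕ} (M : Matrix (Fin n) (Fin n) ℝ) : Prop :=
  ∀ μ ∈ spectrum ℂ (M.map (algebraMap ℝ ℂ)), ‖μ‖ < 1

/-- `(A, B)` is stabilizable. -/
def IsStabilizable {n l : ℕ} (A : Matrix (Fin n) (Fin n) ℝ) (B : Matrix (Fin n) (Fin l) ℝ) :
    Prop :=
  ∃ F : Matrix (Fin l) (Fin n) ℝ, IsSchur (A + B * F)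

/-- `(A, C)` is detectable. -/
def IsDetectable {n p : ℕ} (A : Matrix (Fin n) (Fin n) ℝ) (C : Matrix (Fin p) (Fin n) ℝ) :
    Prop :=
  ∃ L : Matrix (Fin n) (Fin p) ℝ, IsSchur (A + L * C)

/-- The class `K∞` of comparison functions on `[0, ∞)`. Values at negative arguments are
irrelevant. -/
structure IsKInfty (α : ℝ → ℝ) : Prop where
  continuousOn : ContinuousOn α (Set.Ici 0)
  strictMonoOn : StrictMonoOn α (Set.Ici 0)
  map_zero : α 0 = 0
  tendsto_atTop : Tendsto α atTop atTop

/-- The quadratic form `xᵀ M x`. -/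
def quadForm {d : ℕ} (M : Matrix (Fin d) (Fin d) ℝ) (x : Fin d → ℝ) : ℝ := x ⬝ᵥ (M *ᵥ x)

/-- The squared Euclidean norm `‖x‖² = xᵀ x`. (The norm instance on `Fin d → ℝ` is the sup norm;
it is used below only for square integrability, which does not depend on the choice of norm.) -/
def sqNorm {d : ℕ} (x : Fin d → ℝ) : ℝ := x ⬝ᵥ x

/-- Probability measures on `ℝ^d` with finite second moment. -/
def IsP2 {d : ℕ} (ρ : Measure (Fin d → ℝ)) : Prop :=
  IsProbabilityMeasure ρ ∧ Integrable (fun x => sqNorm x) ρ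

/-- The data of a generalized linear-quadratic stochastic optimal control problem: the dynamics
`f(x,u,w) = A x + B u + E w + z` and the coefficients of the stage cost. -/
structure LQData (n l m : ℕ) where
  A : Matrix (Fin n) (Fin n) ℝ
  B : Matrix (Fin n) (Fin l) ℝ
  E : Matrix (Fin n) (Fin m) ℝ
  z : Fin n → ℝ
  Q₁ : Matrix (Fin n) (Fin n) ℝ
  Q₂ : Matrix (Fin n) (Fin n) ℝ
  R₁ : Matrix (Fin l) (Fin l) ℝ
  R₂ : Matrix (Fin l) (Fin l) ℝ
  s : Fin n → ℝ
  v : Fin l → ℝ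
  c : ℝ

section Prob

variable {Ω : Type*} [MeasurableSpace Ω]

/-- The covariance matrix of a random vector. -/
def covMatrix {d : ℕ} (μ : Measure Ω) (X : Ω → Fin d → ℝ) : Matrix (Fin d) (Fin d) ℝ :=
  Matrix.of fun i j => covariance (fun ω => X ω i) (fun ω => X ω j) μ

namespace LQData

variable {n l m : ℕ} (D : LQData n l m)

/-- The dynamics `f(x,u,w) = A x + B u + E w + z`. -/
def f (x : Fin n → ℝ) (u : Fin l → ℝ) (w : Fin m → ℝ) : Fin n → ℝ :=
  D.A *ᵥ x + D.B *ᵥ u + D.E *ᵥ w + D.z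

/-- The stage cost
`ℓ(X,U) = E[Xᵀ Q₁ X + Uᵀ R₁ U + sᵀ X + vᵀ U + c] + Tr(Q₂ Cov(X)) + Tr(R₂ Cov(U))`. -/
def stageCost (μ : Measure Ω) (X : Ω → Fin n → ℝ) (U : Ω → Fin l → ℝ) : ℝ :=
  (∫ ω, (quadForm D.Q₁ (X ω) + quadForm D.R₁ (U ω) + D.s ⬝ᵥ X ω + D.v ⬝ᵥ U ω + D.c) ∂μ)
    + (Matrix.trace (D.Q₂ * covMatrix μ X) + Matrix.trace (D.R₂ * covMatrix μ U))

/-- The solution `X_U(·, X₀)` of `X(k+1) = f(X(k), U(k), W(k))`, `X(0) = X₀`. -/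
def traj (W : ℕ → Ω → Fin m → ℝ) (X₀ : Ω → Fin n → ℝ) (U : ℕ → Ω → Fin l → ℝ) :
    ℕ → Ω → Fin n → ℝ
  | 0 => X₀
  | k + 1 => fun ω => D.f (traj W X₀ U k ω) (U k ω) (W k ω)

/-- The cost `J_N(X₀, U)`. -/
def cost (μ : Measure Ω) (W : ℕ → Ω → Fin m → ℝ) (N : ℕ) (X₀ : Ω → Fin n → ℝ)
    (U : ℕ → Ω → Fin l → ℝ) : ℝ :=
  ∑ k ∈ Finset.range N, D.stageCost μ (D.traj W X₀ U k) (U k)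

/-- `σ(X(0), …, X(k))`. -/
abbrev pastSigma (X : ℕ → Ω → Fin n → ℝ) (k : ℕ) : MeasurableSpace Ω :=
  ⨆ j ∈ Finset.range (k + 1), MeasurableSpace.comap (X j) inferInstance

/-- `(X, U)` is causal at time `k`: `U(k)` is (up to a null set) a square integrable function
measurable with respect to `σ(X(0), …, X(k))`, and `W(k)` is independent of `X(k)` and
of `U(k)`. -/
structure IsCausalAt (μ : Measure Ω) (W : ℕ → Ω → Fin m → ℝ) (X : ℕ → Ω → Fin n → ℝ)
    (U : ℕ → Ω → Fin l → ℝ) (k : ℕ) : Prop where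
  memLp : MemLp (U k) 2 μ
  adapted : AEStronglyMeasurable[pastSigma X k] (U k) μ
  indep_state : IndepFun (W k) (X k) μ
  indep_control : IndepFun (W k) (U k) μ

/-- `U(0), …, U(N-1)` is an admissible control process for the initial value `X₀` on the
horizon `N`. -/
def IsAdmissible (μ : Measure Ω) (W : ℕ → Ω → Fin m → ℝ) (N : ℕ) (X₀ : Ω → Fin n → ℝ)
    (U : ℕ → Ω → Fin l → ℝ) : Prop :=
  ∀ k < N, IsCausalAt μ W (D.traj W X₀ U) U k

/-- Stationary pairs of state and control processes. -/
structure IsStationaryPair (μ : Measure Ω) (W : ℕ → Ω → Fin m → ℝ) (Xs : ℕ → Ω → Fin n → ℝ)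
    (Us : ℕ → Ω → Fin l → ℝ) : Prop where
  causal : ∀ k, IsCausalAt μ W Xs Us k
  law_state : ∃ ρ : Measure (Fin n → ℝ), IsP2 ρ ∧ ∀ k, HasLaw (Xs k) ρ μ
  law_control : ∃ ρ : Measure (Fin l → ℝ), IsP2 ρ ∧ ∀ k, HasLaw (Us k) ρ μ
  dynamics : ∀ k ω, Xs (k + 1) ω = D.f (Xs k ω) (Us k ω) (W k ω)

/-- Strict dissipativity in `L²` at `(Xs, Us)` with storage function `lam` and comparison
function `α`. The inequality is required for all square integrable `X`, `U` that are
independent of `W(k)`; this includes `X(k)`, `U(k)` for every admissible process. -/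
structure IsStrictlyDissipativeWith (μ : Measure Ω) (W : ℕ → Ω → Fin m → ℝ)
    (Xs : ℕ → Ω → Fin n → ℝ) (Us : ℕ → Ω → Fin l → ℝ)
    (lam : ℕ → (Ω → Fin n → ℝ) → ℝ) (α : ℝ → ℝ) : Prop where
  kInfty : IsKInfty α
  bddBelow : ∃ M : ℝ, ∀ k, ∀ X : Ω → Fin n → ℝ, MemLp X 2 μ → M ≤ lam k X
  dissipation : ∀ k, ∀ (X : Ω → Fin n → ℝ) (U : Ω → Fin l → ℝ),
    MemLp X 2 μ → MemLp U 2 μ → IndepFun (W k) X μ → IndepFun (W k) U μ →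
    α (∫ ω, sqNorm (X ω - Xs k ω) ∂μ) ≤
      D.stageCost μ X U - D.stageCost μ (Xs k) (Us k)
        + lam k X - lam (k + 1) (fun ω => D.f (X ω) (U ω) (W k ω))

/-- The discrete-time algebraic Riccati equation. -/
def IsRiccatiSolution (P : Matrix (Fin n) (Fin n) ℝ) : Prop :=
  P = D.Aᵀ * P * D.A + (D.Q₁ + D.Q₂)
    - D.Aᵀ * P * D.B * ((D.R₁ + D.R₂) + D.Bᵀ * P * D.B)⁻¹ * D.Bᵀ * P * D.A

/-- The gain `K = -[(R₁ + R₂) + Bᵀ P B]⁻¹ Bᵀ P A`. -/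
def gain (P : Matrix (Fin n) (Fin n) ℝ) : Matrix (Fin l) (Fin n) ℝ :=
  -(((D.R₁ + D.R₂) + D.Bᵀ * P * D.B)⁻¹ * D.Bᵀ * P * D.A)

/-- The affine feedback `π(x) = K (x - x̄) + ū` with `K` the gain of `P`. -/
def feedback (P : Matrix (Fin n) (Fin n) ℝ) (xbar : Fin n → ℝ) (ubar : Fin l → ℝ)
    (x : Fin n → ℝ) : Fin l → ℝ :=
  D.gain P *ᵥ (x - xbar) + ubar

/-- The closed-loop state process `X(k+1) = f(X(k), π(X(k)), W(k))`, `X(0) = X₀`. -/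
def closedLoop (W : ℕ → Ω → Fin m → ℝ) (π : (Fin n → ℝ) → (Fin l → ℝ)) (X₀ : Ω → Fin n → ℝ) :
    ℕ → Ω → Fin n → ℝ
  | 0 => X₀
  | k + 1 => fun ω => D.f (closedLoop W π X₀ k ω) (π (closedLoop W π X₀ k ω)) (W k ω)

/-- `ρ` is invariant for the closed loop under `π` with noise distribution `ρW`. -/
def IsInvariant (π : (Fin n → ℝ) → (Fin l → ℝ)) (ρW : Measure (Fin m → ℝ))
    (ρ : Measure (Fin n → ℝ)) : Prop :=
  (ρ.prod ρW).map (fun p => D.f p.1 (π p.1) p.2) = ρ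

/-- The time-varying storage function
`λ(k,X) = E[‖X - (Xs(k) - x̃)‖²_{P+S} - ‖X - xˢ‖²_P + qᵀ (X - (Xs(k) - x̃))]`. -/
def storage (μ : Measure Ω) (P S : Matrix (Fin n) (Fin n) ℝ) (q xs xt : Fin n → ℝ)
    (Xs : ℕ → Ω → Fin n → ℝ) (k : ℕ) (X : Ω → Fin n → ℝ) : ℝ :=
  ∫ ω, (quadForm (P + S) (X ω - (Xs k ω - xt)) - quadForm P (X ω - xs)
    + q ⬝ᵥ (X ω - (Xs k ω - xt))) ∂μ

/-- The mean-square turnpike property at `(Xs, Us)` with comparison function `α`. -/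
def HasMeanSquareTurnpike (μ : Measure Ω) (W : ℕ → Ω → Fin m → ℝ) (Xs : ℕ → Ω → Fin n → ℝ)
    (Us : ℕ → Ω → Fin l → ℝ) (α : ℝ → ℝ) : Prop :=
  ∀ X₀ : Ω → Fin n → ℝ, MemLp X₀ 2 μ → ∃ C : ℝ,
    ∀ (N : ℕ) (δ : ℝ), 0 < δ → ∀ U : ℕ → Ω → Fin l → ℝ, D.IsAdmissible μ W N X₀ U →
      D.cost μ W N X₀ U ≤ δ + ∑ k ∈ Finset.range N, D.stageCost μ (Xs k) (Us k) →
      ∀ ε : ℝ, 0 < ε →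
        (N : ℝ) - (δ + C) / α ε ≤
          (((Finset.range N).filter fun k =>
            ∫ ω, sqNorm (D.traj W X₀ U k ω - Xs k ω) ∂μ ≤ ε).card : ℝ)

end LQData

/-- The probability space is rich enough to carry, for every square integrable distribution on
`ℝⁿ`, an initial value with this distribution that is independent of the whole noise sequence. -/
def CarriesInitialValues {m : ℕ} (n : ℕ) (μ : Measure Ω) (W : ℕ → Ω → Fin m → ℝ) : Prop :=
  ∀ ρ : Measure (Fin n → ℝ), IsP2 ρ →
    ∃ X₀ : Ω → Fin n → ℝ, HasLaw X₀ ρ μ ∧ IndepFun X₀ (fun ω k => W k ω) μ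

end Prob

end

/-!
By the Riccati equation, `ℓ(X, U)` plus the expected increment of `‖X - xˢ‖²_P` is, up to constants
and terms in the means, the squared deviation of `U` from the feedback, weighted by
`R₁ + R₂ + BᵀPB`. Linear terms are removed by moving the steady state to the minimiser `xˢ + x̃` of
the deterministic stage cost, whose Lagrange multiplier enters `q`; the covariance terms are handled
by Jensen's inequality. What remains is strict by detectability of `(A, Q₁^{1/2})`: it provides a
positive definite `S` such that `‖x‖²_{Q₁} + ‖u‖²_{R₁}` exceeds the increment of `‖x‖²_S` under
`x ↦ Ax + Bu` by at least a multiple of `‖x‖²`. As an arbitrary process and the stationary one are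
driven by the same noise, it cancels in their difference, to which this inequality applies.

The same inequality shows that `A + BK` contracts `P + S`, so it is Schur stable and the invariant
law is that of a convergent noise series. The turnpike property follows by telescoping the
dissipation inequality and counting the times at which the mean-square distance exceeds `ε`.
-/

section QuadraticForms

variable {d e : ℕ}

theorem sqNorm_eq_sum (x : Fin d → ℝ) : sqNorm x = ∑ i, x i ^ 2 := by
  simp only [sqNorm, dotProduct, sq]

theorem sqNorm_nonneg (x : Fin d → ℝ) : 0 ≤ sqNorm x :=
  dotProduct_star_self_nonneg x

theorem sqNorm_pos {x : Fin d → ℝ} (hx : x ≠ 0) : 0 < sqNorm x :=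
  (sqNorm_nonneg x).lt_of_ne' (dotProduct_self_eq_zero.not.2 hx)

theorem quadForm_one (x : Fin d → ℝ) : quadForm 1 x = sqNorm x := by
  rw [quadForm, Matrix.one_mulVec, sqNorm]

theorem quadForm_zero (M : Matrix (Fin d) (Fin d) ℝ) : quadForm M 0 = 0 :=
  zero_dotProduct _

theorem quadForm_nonneg {M : Matrix (Fin d) (Fin d) ℝ} (hM : M.PosSemidef) (x : Fin d → ℝ) :
    0 ≤ quadForm M x :=
  hM.dotProduct_mulVec_nonneg x

theorem quadForm_smul (M : Matrix (Fin d) (Fin d) ℝ) (c : ℝ) (x : Fin d → ℝ) :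
    quadForm M (c • x) = c ^ 2 * quadForm M x := by
  simp only [quadForm, Matrix.mulVec_smul, dotProduct_smul, smul_dotProduct, smul_eq_mul]
  ring

theorem quadForm_add_matrix (M N : Matrix (Fin d) (Fin d) ℝ) (x : Fin d → ℝ) :
    quadForm (M + N) x = quadForm M x + quadForm N x := by
  rw [quadForm, Matrix.add_mulVec, dotProduct_add, quadForm, quadForm]

theorem quadForm_sub_matrix (M N : Matrix (Fin d) (Fin d) ℝ) (x : Fin d → ℝ) :
    quadForm (M - N) x = quadForm M x - quadForm N x := by
  rw [quadForm, Matrix.sub_mulVec, dotProduct_sub, quadForm, quadForm]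

theorem quadForm_smul_matrix (c : ℝ) (M : Matrix (Fin d) (Fin d) ℝ) (x : Fin d → ℝ) :
    quadForm (c • M) x = c * quadForm M x := by
  rw [quadForm, Matrix.smul_mulVec, dotProduct_smul, smul_eq_mul, quadForm]

theorem quadForm_transpose_mul_mul (M : Matrix (Fin d) (Fin d) ℝ) (N : Matrix (Fin d) (Fin e) ℝ)
    (x : Fin e → ℝ) : quadForm (Nᵀ * M * N) x = quadForm M (N *ᵥ x) := by
  rw [quadForm, ← Matrix.mulVec_mulVec, ← Matrix.mulVec_mulVec, Matrix.dotProduct_mulVec,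
    Matrix.vecMul_transpose, quadForm]

theorem quadForm_transpose_mul_self (N : Matrix (Fin d) (Fin e) ℝ) (x : Fin e → ℝ) :
    quadForm (Nᵀ * N) x = sqNorm (N *ᵥ x) := by
  rw [← quadForm_one, ← quadForm_transpose_mul_mul, Matrix.mul_one]

theorem dotProduct_mulVec_comm {M : Matrix (Fin d) (Fin d) ℝ} (hM : M.IsSymm)
    (x y : Fin d → ℝ) : x ⬝ᵥ (M *ᵥ y) = y ⬝ᵥ (M *ᵥ x) := by
  rw [Matrix.dotProduct_mulVec, ← Matrix.mulVec_transpose, hM.eq, dotProduct_comm]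

theorem quadForm_add {M : Matrix (Fin d) (Fin d) ℝ} (hM : M.IsSymm) (x y : Fin d → ℝ) :
    quadForm M (x + y) = quadForm M x + 2 * (x ⬝ᵥ (M *ᵥ y)) + quadForm M y := by
  simp only [quadForm, Matrix.mulVec_add, dotProduct_add, add_dotProduct]
  rw [dotProduct_mulVec_comm hM y x]
  ring

theorem quadForm_sub {M : Matrix (Fin d) (Fin d) ℝ} (hM : M.IsSymm) (x y : Fin d → ℝ) :
    quadForm M (x - y) = quadForm M x - 2 * (x ⬝ᵥ (M *ᵥ y)) + quadForm M y := by
  rw [sub_eq_add_neg, quadForm_add hM, Matrix.mulVec_neg, dotProduct_neg, ← neg_one_smul ℝ y,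
    quadForm_smul]
  ring

theorem isSymm_of_posSemidef {M : Matrix (Fin d) (Fin d) ℝ} (hM : M.PosSemidef) : M.IsSymm :=
  Matrix.isHermitian_iff_isSymm.1 hM.isHermitian

theorem posSemidef_of_quadForm_nonneg {M : Matrix (Fin d) (Fin d) ℝ} (hM : M.IsSymm)
    (h : ∀ x, 0 ≤ quadForm M x) : M.PosSemidef :=
  .of_dotProduct_mulVec_nonneg (Matrix.isHermitian_iff_isSymm.2 hM) h

theorem quadForm_le_of_le {M N : Matrix (Fin d) (Fin d) ℝ} (h : M ≤ N) (x : Fin d → ℝ) :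
    quadForm M x ≤ quadForm N x := by
  rw [← sub_nonneg, ← quadForm_sub_matrix]
  exact quadForm_nonneg h x

theorem le_of_quadForm_le {M N : Matrix (Fin d) (Fin d) ℝ} (hM : M.IsSymm) (hN : N.IsSymm)
    (h : ∀ x, quadForm M x ≤ quadForm N x) : M ≤ N :=
  posSemidef_of_quadForm_nonneg (hN.sub hM) fun x => by
    rw [quadForm_sub_matrix]
    exact sub_nonneg.2 (h x)

theorem two_mul_dotProduct_mulVec_le {M : Matrix (Fin d) (Fin d) ℝ} (hM : M.PosSemidef)
    {η : ℝ} (hη : 0 < η) (x y : Fin d → ℝ) :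
    2 * (x ⬝ᵥ (M *ᵥ y)) ≤ η * quadForm M x + η⁻¹ * quadForm M y := by
  have h := quadForm_nonneg hM (η • x - y)
  rw [quadForm_sub (isSymm_of_posSemidef hM), quadForm_smul, smul_dotProduct, smul_eq_mul] at h
  refine le_of_mul_le_mul_left ?_ hη
  rw [mul_add, mul_inv_cancel_left₀ hη.ne']
  linarith

theorem two_mul_dotProduct_le {η : ℝ} (hη : 0 < η) (x y : Fin d → ℝ) :
    2 * (x ⬝ᵥ y) ≤ η * sqNorm x + η⁻¹ * sqNorm y := by
  simpa only [Matrix.one_mulVec, quadForm_one] using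
    two_mul_dotProduct_mulVec_le Matrix.PosSemidef.one hη x y

theorem quadForm_add_le {M : Matrix (Fin d) (Fin d) ℝ} (hM : M.PosSemidef)
    {η : ℝ} (hη : 0 < η) (x y : Fin d → ℝ) :
    quadForm M (x + y) ≤ (1 + η) * quadForm M x + (1 + η⁻¹) * quadForm M y := by
  rw [quadForm_add (isSymm_of_posSemidef hM)]
  linarith [two_mul_dotProduct_mulVec_le hM hη x y]

theorem sqNorm_sub_le (x y : Fin d → ℝ) : sqNorm (x - y) ≤ 2 * (sqNorm x + sqNorm y) := by
  have h : sqNorm (x - y) + sqNorm (x + y) = 2 * (sqNorm x + sqNorm y) := by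
    simp only [sqNorm, sub_dotProduct, dotProduct_sub, add_dotProduct, dotProduct_add]
    ring
  linarith [sqNorm_nonneg (x + y)]

theorem sqNorm_mulVec_le_sum_sq_mul (M : Matrix (Fin d) (Fin e) ℝ) (x : Fin e → ℝ) :
    sqNorm (M *ᵥ x) ≤ (∑ i, ∑ j, M i j ^ 2) * sqNorm x := by
  rw [sqNorm_eq_sum, sqNorm_eq_sum, Finset.sum_mul]
  exact Finset.sum_le_sum fun i _ => Finset.sum_mul_sq_le_sq_mul_sq Finset.univ (M i) x

theorem exists_sqNorm_mulVec_le (M : Matrix (Fin d) (Fin e) ℝ) :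
    ∃ c : ℝ, 0 < c ∧ ∀ x, sqNorm (M *ᵥ x) ≤ c * sqNorm x := by
  refine ⟨(∑ i, ∑ j, M i j ^ 2) + 1, by positivity, fun x => ?_⟩
  linarith [sqNorm_mulVec_le_sum_sq_mul M x, sqNorm_nonneg x]

theorem exists_quadForm_le_mul_sqNorm (M : Matrix (Fin d) (Fin d) ℝ) :
    ∃ c : ℝ, 0 < c ∧ ∀ x, quadForm M x ≤ c * sqNorm x := by
  obtain ⟨c, hc, hMc⟩ := exists_sqNorm_mulVec_le M
  refine ⟨1 + c, by positivity, fun x => ?_⟩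
  rw [quadForm]
  linarith [two_mul_dotProduct_le one_pos x (M *ᵥ x), hMc x, sqNorm_nonneg x,
    sqNorm_nonneg (M *ᵥ x)]

theorem exists_mul_sqNorm_le_quadForm {M : Matrix (Fin d) (Fin d) ℝ} (hM : M.PosDef) :
    ∃ c : ℝ, 0 < c ∧ ∀ x, c * sqNorm x ≤ quadForm M x := by
  obtain ⟨c, hc, hMc⟩ := exists_quadForm_le_mul_sqNorm M⁻¹
  refine ⟨c⁻¹, by positivity, fun x => ?_⟩
  have hcancel : M *ᵥ (M⁻¹ *ᵥ x) = x := by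
    rw [Matrix.mulVec_mulVec, Matrix.mul_nonsing_inv _ hM.det_pos.ne'.isUnit, Matrix.one_mulVec]
  have hinv : quadForm M (M⁻¹ *ᵥ x) = quadForm M⁻¹ x := by
    rw [quadForm, hcancel, dotProduct_comm, quadForm]
  -- Young's inequality for `x` and `M⁻¹ x`, whose mixed term is `xᵀ x`.
  have hyoung := two_mul_dotProduct_mulVec_le hM.posSemidef hc x (M⁻¹ *ᵥ x)
  rw [hcancel, hinv, ← sqNorm] at hyoung
  have hle : c⁻¹ * quadForm M⁻¹ x ≤ sqNorm x := (inv_mul_le_iff₀ hc).2 (hMc x)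
  rw [inv_mul_le_iff₀ hc]
  linarith

theorem posDef_of_sqNorm_le_quadForm {M : Matrix (Fin d) (Fin d) ℝ} (hM : M.IsSymm)
    (h : ∀ x, sqNorm x ≤ quadForm M x) : M.PosDef :=
  .of_dotProduct_mulVec_pos (Matrix.isHermitian_iff_isSymm.2 hM) fun x hx =>
    (sqNorm_pos hx).trans_le (h x)

end QuadraticForms

section SchurStability

open scoped ENNReal

theorem tendsto_pow_zero_of_spectralRadius_lt_one {𝔸 : Type*} [NormedRing 𝔸] [NormedAlgebra ℂ 𝔸]
    [CompleteSpace 𝔸] {a : 𝔸} (ha : spectralRadius ℂ a < 1) :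
    Tendsto (fun k => a ^ k) atTop (nhds 0) := by
  obtain ⟨r, har, hr⟩ := ENNReal.lt_iff_exists_nnreal_btwn.1 ha
  have hgelfand :=
    (spectrum.pow_nnnorm_pow_one_div_tendsto_nhds_spectralRadius a).eventually_lt_const har
  have hbound : ∀ᶠ k : ℕ in atTop, ‖a ^ k‖ ≤ (r : ℝ) ^ k := by
    filter_upwards [hgelfand, eventually_gt_atTop 0] with k hk hk0
    have hle : (‖a ^ k‖₊ : ℝ≥0∞) ≤ (r : ℝ≥0∞) ^ (k : ℝ) := by
      rw [← ENNReal.rpow_inv_le_iff (by positivity), ← one_div]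
      exact hk.le
    rw [ENNReal.rpow_natCast] at hle
    exact_mod_cast hle
  exact squeeze_zero_norm' hbound
    (tendsto_pow_atTop_nhds_zero_of_lt_one r.2 (by exact_mod_cast hr))

variable {d : ℕ}

attribute [local instance] Matrix.linftyOpNormedRing Matrix.linftyOpNormedAlgebra

theorem IsSchur.tendsto_pow_apply {M : Matrix (Fin d) (Fin d) ℝ} (hM : IsSchur M) (i j : Fin d) :
    Tendsto (fun k => (M ^ k) i j) atTop (nhds 0) := by
  have : Nonempty (Fin d) := ⟨i⟩
  have hpow := tendsto_pow_zero_of_spectralRadius_lt_one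
    (spectrum.spectralRadius_lt_of_forall_lt (r := 1) (M.map (algebraMap ℝ ℂ)) hM)
  have happly : Continuous fun N : Matrix (Fin d) (Fin d) ℂ => (N i j).re := by fun_prop
  simp only [← Matrix.map_pow] at hpow
  simpa [Function.comp_def] using (happly.tendsto 0).comp hpow

theorem IsSchur.tendsto_sum_sq_pow {M : Matrix (Fin d) (Fin d) ℝ} (hM : IsSchur M) :
    Tendsto (fun k => ∑ i, ∑ j, (M ^ k) i j ^ 2) atTop (nhds 0) := by
  simpa using tendsto_finsetSum Finset.univ fun i _ =>
    tendsto_finsetSum Finset.univ fun j _ => (hM.tendsto_pow_apply i j).pow 2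

/-- The truncated Lyapunov series `∑_{k < N} (M ^ k)ᵀ M ^ k` suffices as soon as `M ^ N` is a
strict contraction. -/
theorem IsSchur.exists_lyapunov {M : Matrix (Fin d) (Fin d) ℝ} (hM : IsSchur M) :
    ∃ S : Matrix (Fin d) (Fin d) ℝ, S.PosDef ∧
      ∀ x, quadForm S (M *ᵥ x) + sqNorm x ≤ quadForm S x := by
  obtain ⟨N, hN, hN0⟩ := ((hM.tendsto_sum_sq_pow.eventually_lt_const one_half_pos).and
    (eventually_gt_atTop 0)).exists
  set S : Matrix (Fin d) (Fin d) ℝ := (2 : ℝ) • ∑ k ∈ Finset.range N, (M ^ k)ᵀ * M ^ k with hS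
  have hquad : ∀ x, quadForm S x = 2 * ∑ k ∈ Finset.range N, sqNorm (M ^ k *ᵥ x) := fun x => by
    simp only [hS, quadForm_smul_matrix, ← quadForm_transpose_mul_self]
    simp only [quadForm, Matrix.sum_mulVec, dotProduct_sum]
  have hsymm : S.IsSymm := by
    simp [Matrix.IsSymm, hS, Matrix.transpose_sum, Matrix.transpose_mul]
  refine ⟨S, posDef_of_sqNorm_le_quadForm hsymm fun x => ?_, fun x => ?_⟩
  · have hfirst := Finset.single_le_sum (f := fun k => sqNorm (M ^ k *ᵥ x))
      (fun k _ => sqNorm_nonneg _) (Finset.mem_range.2 hN0)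
    simp only [pow_zero, Matrix.one_mulVec] at hfirst
    rw [hquad]
    linarith [sqNorm_nonneg x]
  · have htelescope := Finset.sum_range_sub (fun k => sqNorm (M ^ k *ᵥ x)) N
    rw [Finset.sum_sub_distrib, pow_zero, Matrix.one_mulVec] at htelescope
    simp only [hquad, Matrix.mulVec_mulVec, ← pow_succ]
    nlinarith [sqNorm_mulVec_le_sum_sq_mul (M ^ N) x, sqNorm_nonneg x]

theorem IsSchur.exists_lyapunov_add {M : Matrix (Fin d) (Fin d) ℝ} (hM : IsSchur M) :
    ∃ S : Matrix (Fin d) (Fin d) ℝ, S.PosDef ∧ ∃ κ : ℝ, 0 < κ ∧ ∀ x w,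
      quadForm S (M *ᵥ x + w) + sqNorm x ≤ quadForm S x + κ * sqNorm w := by
  obtain ⟨S, hS, hlyap⟩ := hM.exists_lyapunov
  obtain ⟨s, hs, hSs⟩ := exists_quadForm_le_mul_sqNorm S
  refine ⟨(2 : ℝ) • S, hS.smul two_pos, 2 * (1 + 2 * s) * s, by positivity, fun x w => ?_⟩
  simp only [quadForm_smul_matrix]
  have hη : 0 < (2 * s)⁻¹ := by positivity
  have hyoung := quadForm_add_le hS.posSemidef hη (M *ᵥ x) w
  rw [inv_inv] at hyoung
  have hstate : (2 * s)⁻¹ * quadForm S (M *ᵥ x) ≤ 1 / 2 * sqNorm x := by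
    rw [inv_mul_le_iff₀ (by positivity)]
    linarith [hSs x, hlyap x, sqNorm_nonneg x]
  have hinput := mul_le_mul_of_nonneg_left (hSs w) (show 0 ≤ 1 + 2 * s by positivity)
  linarith [hlyap x]

end SchurStability

section Detectability

variable {n p l : ℕ}

/-- Output injection: `A x + w = (A + L C) x + (w - L C x)` with `A + L C` Schur stable. -/
theorem IsDetectable.exists_lyapunov_add {A : Matrix (Fin n) (Fin n) ℝ}
    {C : Matrix (Fin p) (Fin n) ℝ} (hAC : IsDetectable A C) :
    ∃ S : Matrix (Fin n) (Fin n) ℝ, S.PosDef ∧ ∃ κ : ℝ, 0 < κ ∧ ∀ x w,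
      quadForm S (A *ᵥ x + w) + sqNorm x ≤
        quadForm S x + κ * (sqNorm (C *ᵥ x) + sqNorm w) := by
  obtain ⟨L, hL⟩ := hAC
  obtain ⟨S, hS, κ, hκ, hlyap⟩ := hL.exists_lyapunov_add
  obtain ⟨t, ht, hLt⟩ := exists_sqNorm_mulVec_le L
  refine ⟨S, hS, 2 * κ * (t + 1), by positivity, fun x w => ?_⟩
  have hsplit : A *ᵥ x + w = (A + L * C) *ᵥ x + (w - L *ᵥ (C *ᵥ x)) := by
    rw [Matrix.add_mulVec, Matrix.mulVec_mulVec]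
    abel
  have hinput : sqNorm (w - L *ᵥ (C *ᵥ x)) ≤ 2 * (t + 1) * (sqNorm (C *ᵥ x) + sqNorm w) := by
    have htw := mul_nonneg ht.le (sqNorm_nonneg w)
    linarith [sqNorm_sub_le w (L *ᵥ (C *ᵥ x)), hLt (C *ᵥ x), sqNorm_nonneg (C *ᵥ x)]
  rw [hsplit]
  linarith [hlyap x (w - L *ᵥ (C *ᵥ x)), mul_le_mul_of_nonneg_left hinput hκ.le]

theorem sqNorm_sqrt_mulVec {Q : Matrix (Fin n) (Fin n) ℝ} (hQ : Q.PosSemidef) (x : Fin n → ℝ) :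
    sqNorm (CFC.sqrt Q *ᵥ x) = quadForm Q x := by
  have hsymm : (CFC.sqrt Q).IsSymm :=
    isSymm_of_posSemidef (Matrix.nonneg_iff_posSemidef.1 (CFC.sqrt_nonneg Q))
  rw [← quadForm_transpose_mul_self, hsymm.eq,
    CFC.sqrt_mul_sqrt_self Q (Matrix.nonneg_iff_posSemidef.2 hQ)]

theorem IsDetectable.exists_storage_of_sqrt {A : Matrix (Fin n) (Fin n) ℝ}
    (B : Matrix (Fin n) (Fin l) ℝ) {Q : Matrix (Fin n) (Fin n) ℝ} {R : Matrix (Fin l) (Fin l) ℝ}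
    (hQ : Q.PosSemidef) (hR : R.PosDef) (hAQ : IsDetectable A (CFC.sqrt Q)) :
    ∃ S : Matrix (Fin n) (Fin n) ℝ, S.PosDef ∧ ∃ c : ℝ, 0 < c ∧ ∀ x u,
      c * sqNorm x + quadForm S (A *ᵥ x + B *ᵥ u) ≤
        quadForm Q x + quadForm R u + quadForm S x := by
  obtain ⟨S, hS, κ, hκ, hlyap⟩ := hAQ.exists_lyapunov_add
  obtain ⟨r, hr, hRr⟩ := exists_mul_sqNorm_le_quadForm hR
  obtain ⟨b, hb, hBb⟩ := exists_sqNorm_mulVec_le B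
  set K : ℝ := κ * (1 + b * r⁻¹) with hK
  have hK0 : 0 < K := by positivity
  have hcontrol (u) : sqNorm (B *ᵥ u) ≤ b * r⁻¹ * quadForm R u := by
    rw [mul_assoc]
    exact (hBb u).trans (mul_le_mul_of_nonneg_left ((le_inv_mul_iff₀ hr).2 (hRr u)) hb.le)
  have hsupply (x u) : quadForm Q x + sqNorm (B *ᵥ u) ≤
      (1 + b * r⁻¹) * (quadForm Q x + quadForm R u) := by
    have hQx : 0 ≤ b * r⁻¹ * quadForm Q x := mul_nonneg (by positivity) (quadForm_nonneg hQ x)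
    linarith [hcontrol u, quadForm_nonneg hR.posSemidef u]
  refine ⟨K⁻¹ • S, hS.smul (inv_pos.2 hK0), K⁻¹, inv_pos.2 hK0, fun x u => ?_⟩
  have hx := hlyap x (B *ᵥ u)
  rw [sqNorm_sqrt_mulVec hQ] at hx
  rw [quadForm_smul_matrix, quadForm_smul_matrix, ← mul_add, inv_mul_le_iff₀ hK0, mul_add,
    mul_inv_cancel_left₀ hK0.ne', hK, mul_assoc κ]
  linarith [mul_le_mul_of_nonneg_left (hsupply x u) hκ.le]

end Detectability

section Riccati

variable {n l : ℕ}

/-- The operator of which the solutions of the algebraic Riccati equation with state weight `Q`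
and control weight `R` are the fixed points. -/
noncomputable def riccatiMap (A : Matrix (Fin n) (Fin n) ℝ) (B : Matrix (Fin n) (Fin l) ℝ)
    (Q : Matrix (Fin n) (Fin n) ℝ) (R : Matrix (Fin l) (Fin l) ℝ)
    (P : Matrix (Fin n) (Fin n) ℝ) : Matrix (Fin n) (Fin n) ℝ :=
  Aᵀ * P * A + Q - Aᵀ * P * B * (R + Bᵀ * P * B)⁻¹ * Bᵀ * P * A

/-- The feedback gain attaining the minimum over `u` in the Bellman operator
`x ↦ P(A x + B u) + Q(x) + R(u)` of the quadratic form `P`. -/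
noncomputable def riccatiGain (A : Matrix (Fin n) (Fin n) ℝ) (B : Matrix (Fin n) (Fin l) ℝ)
    (R : Matrix (Fin l) (Fin l) ℝ) (P : Matrix (Fin n) (Fin n) ℝ) : Matrix (Fin l) (Fin n) ℝ :=
  -((R + Bᵀ * P * B)⁻¹ * Bᵀ * P * A)

variable {A : Matrix (Fin n) (Fin n) ℝ} {B : Matrix (Fin n) (Fin l) ℝ}
  {Q : Matrix (Fin n) (Fin n) ℝ} {R : Matrix (Fin l) (Fin l) ℝ} {P P' : Matrix (Fin n) (Fin n) ℝ}

theorem posDef_add_transpose_mul_mul (hR : R.PosDef) (hP : P.PosSemidef) :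
    (R + Bᵀ * P * B).PosDef :=
  hR.add_posSemidef (hP.conjTranspose_mul_mul_same B)

theorem quadForm_add_two_mul_dotProduct {M : Matrix (Fin l) (Fin l) ℝ} (hM : M.PosDef)
    (u g : Fin l → ℝ) :
    quadForm M u + 2 * (u ⬝ᵥ g) = quadForm M (u + M⁻¹ *ᵥ g) - quadForm M⁻¹ g := by
  have hcancel : M *ᵥ (M⁻¹ *ᵥ g) = g := by
    rw [Matrix.mulVec_mulVec, Matrix.mul_nonsing_inv _ hM.det_pos.ne'.isUnit, Matrix.one_mulVec]
  have hinv : quadForm M (M⁻¹ *ᵥ g) = quadForm M⁻¹ g := by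
    rw [quadForm, hcancel, dotProduct_comm, quadForm]
  rw [quadForm_add (isSymm_of_posSemidef hM.posSemidef), hcancel, hinv]
  ring

theorem riccatiMap_eq_of_isSymm (hP : P.IsSymm) :
    riccatiMap A B Q R P =
      Aᵀ * P * A + Q - (Bᵀ * P * A)ᵀ * (R + Bᵀ * P * B)⁻¹ * (Bᵀ * P * A) := by
  simp only [riccatiMap, Matrix.transpose_mul, Matrix.transpose_transpose, hP.eq,
    Matrix.mul_assoc]

theorem isSymm_riccatiMap (hQ : Q.IsSymm) (hR : R.PosDef) (hP : P.PosSemidef) :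
    (riccatiMap A B Q R P).IsSymm := by
  have hinv := isSymm_of_posSemidef (posDef_add_transpose_mul_mul (B := B) hR hP).inv.posSemidef
  rw [riccatiMap_eq_of_isSymm (isSymm_of_posSemidef hP), Matrix.IsSymm]
  simp only [Matrix.transpose_sub, Matrix.transpose_add, Matrix.transpose_mul, hinv.eq, hQ.eq,
    (isSymm_of_posSemidef hP).eq, Matrix.transpose_transpose]
  simp only [Matrix.mul_assoc]

theorem bellman_eq (hR : R.PosDef) (hP : P.PosSemidef) (x : Fin n → ℝ) (u : Fin l → ℝ) :
    quadForm P (A *ᵥ x + B *ᵥ u) + quadForm Q x + quadForm R u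
      = quadForm (riccatiMap A B Q R P) x
        + quadForm (R + Bᵀ * P * B) (u - riccatiGain A B R P *ᵥ x) := by
  have hPs := isSymm_of_posSemidef hP
  set g : Fin l → ℝ := (Bᵀ * P * A) *ᵥ x with hg
  have hcross : (A *ᵥ x) ⬝ᵥ (P *ᵥ (B *ᵥ u)) = u ⬝ᵥ g := by
    rw [dotProduct_mulVec_comm hPs, hg, ← Matrix.mulVec_mulVec, ← Matrix.mulVec_mulVec,
      Matrix.dotProduct_mulVec u, Matrix.vecMul_transpose]
  have hgain : u - riccatiGain A B R P *ᵥ x = u + (R + Bᵀ * P * B)⁻¹ *ᵥ g := by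
    simp only [hg, riccatiGain, Matrix.neg_mulVec, sub_neg_eq_add, Matrix.mulVec_mulVec,
      Matrix.mul_assoc]
  have hsquare := quadForm_add_two_mul_dotProduct (posDef_add_transpose_mul_mul (B := B) hR hP) u g
  rw [quadForm_add_matrix, quadForm_transpose_mul_mul] at hsquare
  rw [hgain, riccatiMap_eq_of_isSymm hPs, quadForm_sub_matrix, quadForm_add_matrix,
    quadForm_transpose_mul_mul, quadForm_transpose_mul_mul, quadForm_add hPs, hcross, ← hg]
  linarith

theorem quadForm_riccatiMap_le (hR : R.PosDef) (hP : P.PosSemidef)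
    (x : Fin n → ℝ) (u : Fin l → ℝ) :
    quadForm (riccatiMap A B Q R P) x
      ≤ quadForm P (A *ᵥ x + B *ᵥ u) + quadForm Q x + quadForm R u := by
  rw [bellman_eq hR hP]
  exact le_add_of_nonneg_right
    (quadForm_nonneg (posDef_add_transpose_mul_mul hR hP).posSemidef _)

theorem quadForm_riccatiMap_eq (hR : R.PosDef) (hP : P.PosSemidef) (x : Fin n → ℝ) :
    quadForm (riccatiMap A B Q R P) x =
      quadForm P (A *ᵥ x + B *ᵥ (riccatiGain A B R P *ᵥ x)) + quadForm Q x
        + quadForm R (riccatiGain A B R P *ᵥ x) := by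
  rw [bellman_eq hR hP, sub_self, quadForm_zero, add_zero]

theorem posSemidef_riccatiMap (hQ : Q.PosSemidef) (hR : R.PosDef) (hP : P.PosSemidef) :
    (riccatiMap A B Q R P).PosSemidef := by
  refine posSemidef_of_quadForm_nonneg
    (isSymm_riccatiMap (isSymm_of_posSemidef hQ) hR hP) fun x => ?_
  rw [quadForm_riccatiMap_eq hR hP]
  exact add_nonneg (add_nonneg (quadForm_nonneg hP _) (quadForm_nonneg hQ _))
    (quadForm_nonneg hR.posSemidef _)

theorem riccatiMap_le_riccatiMap (hQ : Q.IsSymm) (hR : R.PosDef) (hP : P.PosSemidef)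
    (hP' : P'.PosSemidef) (hle : P ≤ P') : riccatiMap A B Q R P ≤ riccatiMap A B Q R P' := by
  refine le_of_quadForm_le (isSymm_riccatiMap hQ hR hP) (isSymm_riccatiMap hQ hR hP')
    fun x => ?_
  rw [quadForm_riccatiMap_eq hR hP']
  refine (quadForm_riccatiMap_le hR hP x (riccatiGain A B R P' *ᵥ x)).trans ?_
  gcongr
  exact quadForm_le_of_le hle _

theorem continuousAt_riccatiMap (hR : R.PosDef) (hP : P.PosSemidef) :
    ContinuousAt (riccatiMap A B Q R) P := by
  have hdet := (posDef_add_transpose_mul_mul (B := B) hR hP).det_pos.ne'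
  have hinv : ContinuousAt (fun P : Matrix (Fin n) (Fin n) ℝ => (R + Bᵀ * P * B)⁻¹) P := by
    refine ContinuousAt.comp (f := fun P => R + Bᵀ * P * B) (continuousAt_matrix_inv _ ?_)
      (Continuous.continuousAt (by fun_prop))
    simpa only [Ring.inverse_eq_inv'] using continuousAt_inv₀ hdet
  have hjoint : Continuous fun N : Matrix (Fin n) (Fin n) ℝ × Matrix (Fin l) (Fin l) ℝ =>
      Aᵀ * N.1 * A + Q - Aᵀ * N.1 * B * N.2 * Bᵀ * N.1 * A := by fun_prop
  exact hjoint.continuousAt.comp_of_eq (f := fun P => (P, (R + Bᵀ * P * B)⁻¹))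
    (continuousAt_id.prodMk hinv) rfl

theorem apply_eq_polarization {M : Matrix (Fin n) (Fin n) ℝ} (hM : M.IsSymm) (i j : Fin n) :
    M i j = (quadForm M (Pi.single i 1 + Pi.single j 1) - quadForm M (Pi.single i 1)
      - quadForm M (Pi.single j 1)) / 2 := by
  rw [quadForm_add hM, Matrix.mulVec_single_one, single_one_dotProduct, Matrix.col_apply]
  ring

theorem exists_tendsto_of_monotone_of_le {P : ℕ → Matrix (Fin n) (Fin n) ℝ}
    (hP : ∀ k, (P k).IsSymm) (hmono : Monotone P) {T : Matrix (Fin n) (Fin n) ℝ}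
    (hT : ∀ k, P k ≤ T) : ∃ L, Tendsto P atTop (nhds L) := by
  have hquad (x) : ∃ a, Tendsto (fun k => quadForm (P k) x) atTop (nhds a) :=
    ⟨_, tendsto_atTop_ciSup (fun _ _ h => quadForm_le_of_le (hmono h) x)
      ⟨quadForm T x, Set.forall_mem_range.2 fun k => quadForm_le_of_le (hT k) x⟩⟩
  choose a ha using hquad
  refine ⟨Matrix.of fun i j =>
    (a (Pi.single i 1 + Pi.single j 1) - a (Pi.single i 1) - a (Pi.single j 1)) / 2,
    tendsto_pi_nhds.2 fun i => tendsto_pi_nhds.2 fun j => ?_⟩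
  simp only [fun k => apply_eq_polarization (hP k) i j]
  exact (((ha _).sub (ha _)).sub (ha _)).div_const 2

theorem posSemidef_of_tendsto {P : ℕ → Matrix (Fin n) (Fin n) ℝ} (hP : ∀ k, (P k).PosSemidef)
    {L : Matrix (Fin n) (Fin n) ℝ} (hL : Tendsto P atTop (nhds L)) : L.PosSemidef := by
  have hsymm : L.IsSymm :=
    tendsto_nhds_unique ((continuous_id.matrix_transpose.tendsto L).comp hL)
      (hL.congr fun k => (isSymm_of_posSemidef (hP k)).eq.symm)
  refine posSemidef_of_quadForm_nonneg hsymm fun x => ?_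
  have hquad : Continuous fun M : Matrix (Fin n) (Fin n) ℝ => quadForm M x := by
    unfold quadForm
    fun_prop
  exact ge_of_tendsto' ((hquad.tendsto L).comp hL) fun k => quadForm_nonneg (hP k) x

/-- The cost matrix of any stabilizing linear feedback dominates value iteration. -/
theorem IsStabilizable.exists_riccatiMap_le (hAB : IsStabilizable A B) (hQ : Q.PosSemidef)
    (hR : R.PosDef) :
    ∃ T : Matrix (Fin n) (Fin n) ℝ, T.PosSemidef ∧ riccatiMap A B Q R T ≤ T := by
  obtain ⟨F, hF⟩ := hAB
  obtain ⟨S, hS, hlyap⟩ := hF.exists_lyapunov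
  obtain ⟨c, hc, hcost⟩ := exists_quadForm_le_mul_sqNorm (Q + Fᵀ * R * F)
  have hT : (c • S).PosSemidef := hS.posSemidef.smul hc.le
  refine ⟨c • S, hT, le_of_quadForm_le (isSymm_riccatiMap (isSymm_of_posSemidef hQ) hR hT)
    (isSymm_of_posSemidef hT) fun x => (quadForm_riccatiMap_le hR hT x (F *ᵥ x)).trans ?_⟩
  have hx := hcost x
  rw [quadForm_add_matrix, quadForm_transpose_mul_mul] at hx
  have hstep := mul_le_mul_of_nonneg_left (hlyap x) hc.le
  rw [Matrix.add_mulVec, ← Matrix.mulVec_mulVec] at hstep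
  rw [quadForm_smul_matrix, quadForm_smul_matrix]
  linarith

theorem exists_riccatiMap_eq_of_le (hQ : Q.PosSemidef) (hR : R.PosDef)
    {T : Matrix (Fin n) (Fin n) ℝ} (hT : T.PosSemidef) (hTle : riccatiMap A B Q R T ≤ T) :
    ∃ P : Matrix (Fin n) (Fin n) ℝ, P.PosSemidef ∧ P = riccatiMap A B Q R P := by
  have hQs := isSymm_of_posSemidef hQ
  let V : ℕ → Matrix (Fin n) (Fin n) ℝ := fun k => (riccatiMap A B Q R)^[k] 0
  have hsucc (k) : V (k + 1) = riccatiMap A B Q R (V k) := Function.iterate_succ_apply' _ _ _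
  have hpsd (k) : (V k).PosSemidef := by
    induction k with
    | zero => exact Matrix.PosSemidef.zero
    | succ k ih => exact hsucc k ▸ posSemidef_riccatiMap hQ hR ih
  have hmono : Monotone V := monotone_nat_of_le_succ fun k => by
    induction k with
    | zero => exact Matrix.nonneg_iff_posSemidef.2 (hpsd 1)
    | succ k ih =>
      rw [hsucc, hsucc (k + 1)]
      exact riccatiMap_le_riccatiMap hQs hR (hpsd _) (hpsd _) ih
  have hbound (k) : V k ≤ T := by
    induction k with
    | zero => exact Matrix.nonneg_iff_posSemidef.2 hT
    | succ k ih => exact hsucc k ▸ (riccatiMap_le_riccatiMap hQs hR (hpsd k) hT ih).trans hTle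
  obtain ⟨P, hP⟩ :=
    exists_tendsto_of_monotone_of_le (fun k => isSymm_of_posSemidef (hpsd k)) hmono hbound
  have hPpsd := posSemidef_of_tendsto hpsd hP
  refine ⟨P, hPpsd, tendsto_nhds_unique ((tendsto_add_atTop_iff_nat 1).2 hP) ?_⟩
  simp only [hsucc]
  exact (continuousAt_riccatiMap hR hPpsd).tendsto.comp hP

theorem IsStabilizable.exists_riccatiMap_eq (hAB : IsStabilizable A B) (hQ : Q.PosSemidef)
    (hR : R.PosDef) : ∃ P : Matrix (Fin n) (Fin n) ℝ, P.PosSemidef ∧ P = riccatiMap A B Q R P := by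
  obtain ⟨T, hT, hTle⟩ := hAB.exists_riccatiMap_le hQ hR
  exact exists_riccatiMap_eq_of_le hQ hR hT hTle

end Riccati

section OptimalSteadyState

/-- First-order conditions for minimizing a quadratic functional with Hessian `H` and linear part
`φ` over the kernel of `G`: existence of a stationary point `y₀` and a Lagrange multiplier `ψ`. -/
theorem exists_lagrangeMultiplier {K V W : Type*} [Field K] [AddCommGroup V] [Module K V]
    [FiniteDimensional K V] [AddCommGroup W] [Module K W] (G : V →ₗ[K] W) (H : V →ₗ[K] V →ₗ[K] K)
    (hH : ∀ y ∈ G.ker, H y y = 0 → y = 0) (φ : Module.Dual K V) :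
    ∃ y₀ ∈ G.ker, ∃ ψ : Module.Dual K W, H y₀ + φ = ψ ∘ₗ G := by
  let Hker : G.ker →ₗ[K] Module.Dual K G.ker :=
    LinearMap.lcomp K K G.ker.subtype ∘ₗ H ∘ₗ G.ker.subtype
  have hinj : Function.Injective Hker :=
    (injective_iff_map_eq_zero Hker).2 fun y hy =>
      Subtype.ext (hH y y.2 (LinearMap.congr_fun hy y))
  have hsurj : Function.Surjective Hker :=
    (LinearMap.injective_iff_surjective_of_finrank_eq_finrank
      Subspace.dual_finrank_eq.symm).1 hinj
  obtain ⟨y₀, hy₀⟩ := hsurj (-(φ.domRestrict G.ker))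
  have hann : H y₀ + φ ∈ G.ker.dualAnnihilator := by
    refine (Submodule.mem_dualAnnihilator _).2 fun y hy => ?_
    exact eq_neg_iff_add_eq_zero.1 (LinearMap.congr_fun hy₀ ⟨y, hy⟩)
  rw [← LinearMap.range_dualMap_eq_dualAnnihilator_ker] at hann
  obtain ⟨ψ, hψ⟩ := hann
  exact ⟨y₀, y₀.2, ψ, hψ.symm⟩

variable {n l m : ℕ}

theorem exists_steadyState_multiplier {A : Matrix (Fin n) (Fin n) ℝ} (B : Matrix (Fin n) (Fin l) ℝ)
    {Q : Matrix (Fin n) (Fin n) ℝ} {R : Matrix (Fin l) (Fin l) ℝ} (hQ : Q.PosSemidef)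
    (hR : R.PosDef) (hobs : ∀ x, A *ᵥ x = x → quadForm Q x = 0 → x = 0)
    (g : Fin n → ℝ) (h : Fin l → ℝ) :
    ∃ (x₀ : Fin n → ℝ) (u₀ : Fin l → ℝ) (p : Fin n → ℝ), A *ᵥ x₀ + B *ᵥ u₀ = x₀ ∧
      ∀ x u, 2 * (x₀ ⬝ᵥ (Q *ᵥ x)) + 2 * (u₀ ⬝ᵥ (R *ᵥ u)) + g ⬝ᵥ x + h ⬝ᵥ u
        + p ⬝ᵥ (x - (A *ᵥ x + B *ᵥ u)) = 0 := by
  let G : (Fin n → ℝ) × (Fin l → ℝ) →ₗ[ℝ] (Fin n → ℝ) :=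
    LinearMap.fst ℝ _ _ - A.mulVecLin.coprod B.mulVecLin
  let H : (Fin n → ℝ) × (Fin l → ℝ) →ₗ[ℝ] (Fin n → ℝ) × (Fin l → ℝ) →ₗ[ℝ] ℝ :=
    (2 : ℝ) • ((Matrix.toLinearMap₂' ℝ Q).compl₁₂ (LinearMap.fst ℝ _ _) (LinearMap.fst ℝ _ _)
      + (Matrix.toLinearMap₂' ℝ R).compl₁₂ (LinearMap.snd ℝ _ _) (LinearMap.snd ℝ _ _))
  have hG (x u) : G (x, u) = x - (A *ᵥ x + B *ᵥ u) := rfl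
  have hH (x u x' u') : H (x, u) (x', u') = 2 * (x ⬝ᵥ (Q *ᵥ x') + u ⬝ᵥ (R *ᵥ u')) := by
    simp [H, Matrix.toLinearMap₂'_apply', mul_add]
  have hdef : ∀ y ∈ G.ker, H y y = 0 → y = 0 := by
    rintro ⟨x, u⟩ hxu hzero
    rw [LinearMap.mem_ker, hG, sub_eq_zero] at hxu
    rw [hH, ← quadForm, ← quadForm] at hzero
    have hQx := quadForm_nonneg hQ x
    have hu : u = 0 := by
      by_contra hu
      have hpos : 0 < quadForm R u := hR.dotProduct_mulVec_pos hu
      linarith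
    have hRu := quadForm_nonneg hR.posSemidef u
    rw [hu, Matrix.mulVec_zero, add_zero] at hxu
    rw [hu, hobs x hxu.symm (by linarith), Prod.mk_zero_zero]
  obtain ⟨⟨x₀, u₀⟩, hker, ψ, hψ⟩ := exists_lagrangeMultiplier G H hdef
    ((dotProductEquiv ℝ _ g).coprod (dotProductEquiv ℝ _ h))
  obtain ⟨p, rfl⟩ := (dotProductEquiv ℝ (Fin n)).surjective ψ
  rw [LinearMap.mem_ker, hG, sub_eq_zero] at hker
  refine ⟨x₀, u₀, -p, hker.symm, fun x u => ?_⟩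
  have hstat := LinearMap.congr_fun hψ (x, u)
  simp only [LinearMap.add_apply, LinearMap.comp_apply, LinearMap.coprod_apply, hH, hG,
    dotProductEquiv_apply_apply] at hstat
  rw [neg_dotProduct]
  linarith

namespace LQData

variable (D : LQData n l m)

/-- The first-order conditions satisfied by a minimizer `(xe, ue)` of
`xᵀ Q₁ x + uᵀ R₁ u + sᵀ x + vᵀ u` over the steady states of the dynamics with constant noise `w`;
`p` is the Lagrange multiplier of the steady state constraint. -/
structure IsOptimalSteadyState (w : Fin m → ℝ) (xe : Fin n → ℝ) (ue : Fin l → ℝ)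
    (p : Fin n → ℝ) : Prop where
  steady : D.f xe ue w = xe
  stationary : ∀ x u, 2 * (xe ⬝ᵥ (D.Q₁ *ᵥ x)) + 2 * (ue ⬝ᵥ (D.R₁ *ᵥ u)) + D.s ⬝ᵥ x + D.v ⬝ᵥ u
    + p ⬝ᵥ (x - (D.A *ᵥ x + D.B *ᵥ u)) = 0

/-- The linear part `A x + B u + E w` of the dynamics, which governs deviations from a
steady state. -/
noncomputable def linearStep (x : Fin n → ℝ) (u : Fin l → ℝ) (w : Fin m → ℝ) : Fin n → ℝ :=
  D.A *ᵥ x + D.B *ᵥ u + D.E *ᵥ w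

theorem f_add (x x' : Fin n → ℝ) (u u' : Fin l → ℝ) (w w' : Fin m → ℝ) :
    D.f (x + x') (u + u') (w + w') = D.linearStep x u w + D.f x' u' w' := by
  simp only [f, linearStep, Matrix.mulVec_add]
  abel

theorem linearStep_sub_linearStep (x x' : Fin n → ℝ) (u u' : Fin l → ℝ) (w : Fin m → ℝ) :
    D.linearStep x u w - D.linearStep x' u' w = D.A *ᵥ (x - x') + D.B *ᵥ (u - u') := by
  simp only [linearStep, Matrix.mulVec_sub]
  abel

variable {D}

theorem exists_isOptimalSteadyState (hQ₁ : D.Q₁.PosSemidef) (hR₁ : D.R₁.PosDef)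
    (hdetect : IsDetectable D.A (CFC.sqrt D.Q₁)) {w : Fin m → ℝ} {xs : Fin n → ℝ}
    {us : Fin l → ℝ} (hsteady : D.f xs us w = xs) :
    ∃ (xt : Fin n → ℝ) (ut : Fin l → ℝ) (p : Fin n → ℝ), D.A *ᵥ xt + D.B *ᵥ ut = xt ∧
      D.IsOptimalSteadyState w (xt + xs) (ut + us) p := by
  have hobs (x) (hAx : D.A *ᵥ x = x) (hQx : quadForm D.Q₁ x = 0) : x = 0 := by
    obtain ⟨S, -, κ, -, hlyap⟩ := hdetect.exists_lyapunov_add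
    have hx := hlyap x 0
    rw [add_zero, hAx, sqNorm_sqrt_mulVec hQ₁, hQx, show sqNorm (0 : Fin n → ℝ) = 0 from
      zero_dotProduct _] at hx
    by_contra hne
    linarith [sqNorm_pos hne]
  obtain ⟨xt, ut, p, hker, hstat⟩ := exists_steadyState_multiplier D.B hQ₁ hR₁ hobs
    (D.s + (2 : ℝ) • (D.Q₁ *ᵥ xs)) (D.v + (2 : ℝ) • (D.R₁ *ᵥ us))
  refine ⟨xt, ut, p, hker, ?_, fun x u => ?_⟩
  · have hf := D.f_add xt xs ut us 0 w
    rwa [linearStep, Matrix.mulVec_zero, add_zero, zero_add, hker, hsteady] at hf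
  · have hxu := hstat x u
    have hQ : (D.Q₁ *ᵥ xs) ⬝ᵥ x = xs ⬝ᵥ (D.Q₁ *ᵥ x) := by
      rw [dotProduct_comm, dotProduct_mulVec_comm (isSymm_of_posSemidef hQ₁)]
    have hR : (D.R₁ *ᵥ us) ⬝ᵥ u = us ⬝ᵥ (D.R₁ *ᵥ u) := by
      rw [dotProduct_comm, dotProduct_mulVec_comm (isSymm_of_posSemidef hR₁.posSemidef)]
    simp only [add_dotProduct, smul_dotProduct, smul_eq_mul, hQ, hR] at hxu ⊢
    linarith

end LQData

end OptimalSteadyState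

section SquareIntegrable

variable {Ω : Type*} [MeasurableSpace Ω] {μ : Measure Ω} {d e : ℕ}

theorem memLp_mulVec (M : Matrix (Fin e) (Fin d) ℝ) {X : Ω → Fin d → ℝ} (hX : MemLp X 2 μ) :
    MemLp (fun ω => M *ᵥ X ω) 2 μ :=
  (LinearMap.toContinuousLinearMap M.mulVecLin).comp_memLp' hX

theorem integrable_dotProduct {X Y : Ω → Fin d → ℝ} (hX : MemLp X 2 μ) (hY : MemLp Y 2 μ) :
    Integrable (fun ω => X ω ⬝ᵥ Y ω) μ := by
  simp only [dotProduct]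
  exact integrable_finsetSum _ fun i _ => (hX.eval i).integrable_mul (hY.eval i)

theorem integrable_quadForm (M : Matrix (Fin d) (Fin d) ℝ) {X : Ω → Fin d → ℝ}
    (hX : MemLp X 2 μ) : Integrable (fun ω => quadForm M (X ω)) μ :=
  integrable_dotProduct hX (memLp_mulVec M hX)

theorem integrable_const_dotProduct (a : Fin d → ℝ) {X : Ω → Fin d → ℝ} (hX : Integrable X μ) :
    Integrable (fun ω => a ⬝ᵥ X ω) μ :=
  (LinearMap.toContinuousLinearMap (dotProductBilin ℝ ℝ a)).integrable_comp hX

theorem memLp_two_iff_integrable_sqNorm {X : Ω → Fin d → ℝ} (hX : AEStronglyMeasurable X μ) :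
    MemLp X 2 μ ↔ Integrable (fun ω => sqNorm (X ω)) μ := by
  refine ⟨fun h => integrable_dotProduct h h, fun h => memLp_pi_iff.2 fun i => ?_⟩
  have hXi : AEStronglyMeasurable (fun ω => X ω i) μ :=
    (continuous_apply i).comp_aestronglyMeasurable hX
  rw [memLp_two_iff_integrable_sq hXi]
  refine h.mono' (hXi.pow 2) (Eventually.of_forall fun ω => ?_)
  rw [Real.norm_of_nonneg (sq_nonneg _), sqNorm_eq_sum]
  exact Finset.single_le_sum (f := fun i => X ω i ^ 2) (fun _ _ => sq_nonneg _)
    (Finset.mem_univ i)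

theorem integral_mulVec (M : Matrix (Fin e) (Fin d) ℝ) {X : Ω → Fin d → ℝ}
    (hX : Integrable X μ) : ∫ ω, M *ᵥ X ω ∂μ = M *ᵥ ∫ ω, X ω ∂μ :=
  (LinearMap.toContinuousLinearMap M.mulVecLin).integral_comp_comm hX

theorem integral_mulVec_eq_zero (M : Matrix (Fin e) (Fin d) ℝ) {X : Ω → Fin d → ℝ}
    (hX : Integrable X μ) (hmean : ∫ ω, X ω ∂μ = 0) : ∫ ω, M *ᵥ X ω ∂μ = 0 := by
  rw [integral_mulVec M hX, hmean, Matrix.mulVec_zero]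

theorem integral_sub_eq_left {E : Type*} [NormedAddCommGroup E] [NormedSpace ℝ E] {X Y : Ω → E}
    (hX : Integrable X μ) (hY : Integrable Y μ) (hmean : ∫ ω, Y ω ∂μ = 0) :
    ∫ ω, (X ω - Y ω) ∂μ = ∫ ω, X ω ∂μ := by
  rw [integral_sub hX hY, hmean, sub_zero]

theorem integral_const_dotProduct (a : Fin d → ℝ) {X : Ω → Fin d → ℝ} (hX : Integrable X μ) :
    ∫ ω, a ⬝ᵥ X ω ∂μ = a ⬝ᵥ ∫ ω, X ω ∂μ :=
  (LinearMap.toContinuousLinearMap (dotProductBilin ℝ ℝ a)).integral_comp_comm hX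

theorem integral_quadForm_add {M : Matrix (Fin d) (Fin d) ℝ} (hM : M.IsSymm)
    {X Y : Ω → Fin d → ℝ} (hX : MemLp X 2 μ) (hY : MemLp Y 2 μ) :
    ∫ ω, quadForm M (X ω + Y ω) ∂μ
      = ∫ ω, quadForm M (X ω) ∂μ + 2 * ∫ ω, X ω ⬝ᵥ (M *ᵥ Y ω) ∂μ
        + ∫ ω, quadForm M (Y ω) ∂μ := by
  have hXY := (integrable_dotProduct hX (memLp_mulVec M hY)).const_mul 2
  simp only [quadForm_add hM]
  rw [integral_add ((integrable_quadForm M hX).fun_add hXY) (integrable_quadForm M hY),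
    integral_add (integrable_quadForm M hX) hXY, integral_const_mul]

theorem integral_quadForm_add_const [IsProbabilityMeasure μ] {M : Matrix (Fin d) (Fin d) ℝ}
    (hM : M.IsSymm) {X : Ω → Fin d → ℝ} (hX : MemLp X 2 μ) (a : Fin d → ℝ) :
    ∫ ω, quadForm M (X ω + a) ∂μ
      = ∫ ω, quadForm M (X ω) ∂μ + 2 * ((M *ᵥ a) ⬝ᵥ ∫ ω, X ω ∂μ) + quadForm M a := by
  rw [integral_quadForm_add hM hX (memLp_const a),
    ← integral_const_dotProduct _ (hX.integrable one_le_two)]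
  simp [dotProduct_comm]

theorem integral_dotProduct_of_indepFun [IsProbabilityMeasure μ] {X Y : Ω → Fin d → ℝ}
    (hXY : IndepFun X Y μ) (hX : MemLp X 2 μ) (hY : MemLp Y 2 μ) :
    ∫ ω, X ω ⬝ᵥ Y ω ∂μ = (∫ ω, X ω ∂μ) ⬝ᵥ ∫ ω, Y ω ∂μ := by
  have hint (i) : Integrable (fun ω => X ω i * Y ω i) μ :=
    (hX.eval i).integrable_mul (hY.eval i)
  simp only [dotProduct]
  rw [integral_finsetSum _ fun i _ => hint i]
  refine Finset.sum_congr rfl fun i _ => ?_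
  rw [eval_integral fun i => (hX.eval i).integrable one_le_two,
    eval_integral fun i => (hY.eval i).integrable one_le_two]
  exact (hXY.comp (measurable_pi_apply i)
    (measurable_pi_apply i)).integral_fun_mul_eq_mul_integral
      (hX.eval i).aestronglyMeasurable (hY.eval i).aestronglyMeasurable

theorem trace_mul_covMatrix [IsProbabilityMeasure μ] (M : Matrix (Fin d) (Fin d) ℝ)
    {X : Ω → Fin d → ℝ} (hX : MemLp X 2 μ) :
    Matrix.trace (M * covMatrix μ X) = ∫ ω, quadForm M (X ω) ∂μ - quadForm M (∫ ω, X ω ∂μ) := by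
  have hint (i j) : Integrable (fun ω => X ω i * (M i j * X ω j)) μ :=
    (hX.eval i).integrable_mul ((hX.eval j).const_mul _)
  simp only [quadForm, dotProduct, Matrix.mulVec, Finset.mul_sum]
  rw [integral_finsetSum _ fun i _ => integrable_finsetSum _ fun j _ => hint i j,
    ← Finset.sum_sub_distrib, Matrix.trace]
  refine Finset.sum_congr rfl fun i _ => ?_
  rw [integral_finsetSum _ fun j _ => hint i j, ← Finset.sum_sub_distrib, Matrix.diag_apply,
    Matrix.mul_apply]
  refine Finset.sum_congr rfl fun j _ => ?_
  rw [eval_integral fun i => (hX.eval i).integrable one_le_two,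
    eval_integral fun i => (hX.eval i).integrable one_le_two, covMatrix, Matrix.of_apply,
    covariance_eq_sub (hX.eval j) (hX.eval i), mul_sub, ← integral_const_mul]
  congr 1
  · exact integral_congr_ae (Eventually.of_forall fun ω => by simp only [Pi.mul_apply]; ring)
  · ring

theorem quadForm_integral_le [IsProbabilityMeasure μ] {M : Matrix (Fin d) (Fin d) ℝ}
    (hM : M.PosSemidef) {X : Ω → Fin d → ℝ} (hX : MemLp X 2 μ) :
    quadForm M (∫ ω, X ω ∂μ) ≤ ∫ ω, quadForm M (X ω) ∂μ := by
  have hcentered : 0 ≤ ∫ ω, quadForm M (X ω + -∫ ω, X ω ∂μ) ∂μ :=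
    integral_nonneg fun ω => quadForm_nonneg hM _
  rw [integral_quadForm_add_const (isSymm_of_posSemidef hM) hX, Matrix.mulVec_neg,
    neg_dotProduct, dotProduct_comm] at hcentered
  have hneg : quadForm M (-∫ ω, X ω ∂μ) = quadForm M (∫ ω, X ω ∂μ) := by
    simp [quadForm, Matrix.mulVec_neg]
  rw [hneg] at hcentered
  have hdef : quadForm M (∫ ω, X ω ∂μ) = (∫ ω, X ω ∂μ) ⬝ᵥ (M *ᵥ ∫ ω, X ω ∂μ) := rfl
  linarith

namespace LQData

variable {n l m : ℕ} (D : LQData n l m) {X : Ω → Fin n → ℝ} {U : Ω → Fin l → ℝ}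
  {V : Ω → Fin m → ℝ}

theorem memLp_linearStep (hX : MemLp X 2 μ) (hU : MemLp U 2 μ) (hV : MemLp V 2 μ) :
    MemLp (fun ω => D.linearStep (X ω) (U ω) (V ω)) 2 μ :=
  ((memLp_mulVec D.A hX).add (memLp_mulVec D.B hU)).add (memLp_mulVec D.E hV)

theorem memLp_f [IsFiniteMeasure μ] (hX : MemLp X 2 μ) (hU : MemLp U 2 μ) (hV : MemLp V 2 μ) :
    MemLp (fun ω => D.f (X ω) (U ω) (V ω)) 2 μ :=
  (D.memLp_linearStep hX hU hV).add (memLp_const D.z)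

theorem integrable_linearStep (hX : Integrable X μ) (hU : Integrable U μ) (hV : Integrable V μ) :
    Integrable (fun ω => D.linearStep (X ω) (U ω) (V ω)) μ :=
  (((LinearMap.toContinuousLinearMap D.A.mulVecLin).integrable_comp hX).add
    ((LinearMap.toContinuousLinearMap D.B.mulVecLin).integrable_comp hU)).add
    ((LinearMap.toContinuousLinearMap D.E.mulVecLin).integrable_comp hV)

theorem integral_linearStep (hX : Integrable X μ) (hU : Integrable U μ) (hV : Integrable V μ) :
    ∫ ω, D.linearStep (X ω) (U ω) (V ω) ∂μ
      = D.linearStep (∫ ω, X ω ∂μ) (∫ ω, U ω ∂μ) (∫ ω, V ω ∂μ) := by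
  have hA := (LinearMap.toContinuousLinearMap D.A.mulVecLin).integrable_comp hX
  have hB := (LinearMap.toContinuousLinearMap D.B.mulVecLin).integrable_comp hU
  have hE := (LinearMap.toContinuousLinearMap D.E.mulVecLin).integrable_comp hV
  simp only [LinearMap.coe_toContinuousLinearMap', Matrix.mulVecLin_apply] at hA hB hE
  simp only [linearStep]
  rw [integral_add (hA.fun_add hB) hE, integral_add hA hB, integral_mulVec _ hX,
    integral_mulVec _ hU, integral_mulVec _ hV]

theorem integral_f [IsProbabilityMeasure μ] (hX : Integrable X μ) (hU : Integrable U μ)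
    (hV : Integrable V μ) :
    ∫ ω, D.f (X ω) (U ω) (V ω) ∂μ = D.f (∫ ω, X ω ∂μ) (∫ ω, U ω ∂μ) (∫ ω, V ω ∂μ) :=
  calc ∫ ω, D.f (X ω) (U ω) (V ω) ∂μ
      = ∫ ω, D.linearStep (X ω) (U ω) (V ω) ∂μ + ∫ _, D.z ∂μ :=
        integral_add (D.integrable_linearStep hX hU hV) (integrable_const _)
    _ = D.f (∫ ω, X ω ∂μ) (∫ ω, U ω ∂μ) (∫ ω, V ω ∂μ) := by
        rw [D.integral_linearStep hX hU hV, integral_const, probReal_univ, one_smul]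
        rfl

end LQData

end SquareIntegrable

section InvariantLaw

open scoped ENNReal

theorem indepFun_prodMk_of_indepFun {Ω α β γ : Type*} [MeasurableSpace Ω] [MeasurableSpace α]
    [MeasurableSpace β] [MeasurableSpace γ] {μ : Measure Ω} [IsProbabilityMeasure μ]
    {X : Ω → α} {Y : Ω → β} {Z : Ω → γ} (hX : AEMeasurable X μ) (hY : AEMeasurable Y μ)
    (hZ : AEMeasurable Z μ) (hXYZ : IndepFun X (fun ω => (Y ω, Z ω)) μ) (hYZ : IndepFun Y Z μ) :
    IndepFun (fun ω => (X ω, Y ω)) Z μ := by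
  have := Measure.isProbabilityMeasure_map hX
  have := Measure.isProbabilityMeasure_map hY
  have := Measure.isProbabilityMeasure_map hZ
  have hXY : IndepFun X Y μ := hXYZ.comp measurable_id measurable_fst
  have hlaw := (indepFun_iff_map_prod_eq_prod_map_map hX (hY.prodMk hZ)).1 hXYZ
  rw [(indepFun_iff_map_prod_eq_prod_map_map hY hZ).1 hYZ] at hlaw
  rw [indepFun_iff_map_prod_eq_prod_map_map (hX.prodMk hY) hZ,
    (indepFun_iff_map_prod_eq_prod_map_map hX hY).1 hXY,
    ← (measurePreserving_prodAssoc (μ.map X) (μ.map Y) (μ.map Z)).symm.map_eq, ← hlaw,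
    AEMeasurable.map_map_of_aemeasurable
      (MeasurableEquiv.measurable _).aemeasurable (hX.prodMk (hY.prodMk hZ))]
  rfl

theorem indepFun_tail_of_iIndepFun {Ω β : Type*} [MeasurableSpace Ω] [MeasurableSpace β]
    {μ : Measure Ω} {W : ℕ → Ω → β} (hW : iIndepFun W μ) (hmeas : ∀ k, Measurable (W k)) (k : ℕ) :
    IndepFun (W k) (fun ω j => W (j + (k + 1)) ω) μ := by
  have hdisj := indep_iSup_of_disjoint (fun i => (hmeas i).comap_le) hW
    (S := {k}) (T := Set.Ioi k) (by simp)
  refine indep_of_indep_of_le_right (indep_of_indep_of_le_left hdisj ?_) ?_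
  · exact le_iSup₂ (f := fun i (_ : i ∈ ({k} : Set ℕ)) =>
      MeasurableSpace.comap (W i) inferInstance) k rfl
  · rw [← measurable_iff_comap_le]
    refine @measurable_pi_lambda _ _ _ (_) _ _ fun j => ?_
    rw [measurable_iff_comap_le]
    exact le_iSup₂ (f := fun i (_ : i ∈ Set.Ioi k) =>
      MeasurableSpace.comap (W i) inferInstance) (j + (k + 1))
        (by simp only [Set.mem_Ioi]; lia)

variable {E : Type*} [NormedAddCommGroup E] [NormedSpace ℝ E] {L : E →L[ℝ] E}

/-- The random series `∑ⱼ Lʲ ωⱼ`, whose law under an i.i.d. sequence `ω` is invariant for the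
recursion `x ↦ L x + ω₀`. -/
noncomputable def noiseSeries (L : E →L[ℝ] E) (ω : ℕ → E) : E :=
  ∑' j, (L ^ j) (ω j)

theorem noiseSeries_eq_add {ω : ℕ → E} (hω : Summable fun j => (L ^ j) (ω j))
    (hshift : Summable fun j => (L ^ j) (ω (j + 1))) :
    noiseSeries L ω = L (noiseSeries L fun j => ω (j + 1)) + ω 0 := by
  rw [noiseSeries, noiseSeries, hω.tsum_eq_zero_add, L.map_tsum hshift, add_comm]
  simp [pow_succ']

variable [MeasurableSpace E] {ν : Measure E} [IsProbabilityMeasure ν] {p : ℝ≥0∞}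

theorem memLp_pow_eval (hν : MemLp id p ν) (j : ℕ) :
    MemLp (fun ω : ℕ → E => (L ^ j) (ω j)) p (Measure.infinitePi fun _ => ν) :=
  (L ^ j).comp_memLp'
    (hν.comp_measurePreserving (measurePreserving_eval_infinitePi (fun _ => ν) j))

theorem tsum_eLpNorm_pow_eval_ne_top (hL : Summable fun j => ‖L ^ j‖) (hν : MemLp id p ν) :
    ∑' j, eLpNorm (fun ω : ℕ → E => (L ^ j) (ω j)) p (Measure.infinitePi fun _ => ν) ≠ ⊤ := by
  have hle (j : ℕ) :
      eLpNorm (fun ω : ℕ → E => (L ^ j) (ω j)) p (Measure.infinitePi fun _ => ν)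
        ≤ ENNReal.ofReal ‖L ^ j‖ * eLpNorm id p ν := by
    have heval := eLpNorm_comp_measurePreserving (p := p) hν.aestronglyMeasurable
      (measurePreserving_eval_infinitePi (fun _ : ℕ => ν) j)
    rw [← heval]
    have hbound (ω : ℕ → E) : ‖(L ^ j) (ω j)‖ ≤ ‖L ^ j‖ * ‖(id ∘ Function.eval j) ω‖ :=
      (L ^ j).le_opNorm (ω j)
    exact eLpNorm_le_mul_eLpNorm_of_ae_le_mul (Eventually.of_forall hbound) p
  refine ne_top_of_le_ne_top ?_ (ENNReal.tsum_le_tsum hle)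
  rw [ENNReal.tsum_mul_right]
  exact ENNReal.mul_ne_top hL.tsum_ofReal_ne_top hν.eLpNorm_ne_top

variable [CompleteSpace E] [Fact (1 ≤ p)]

theorem ae_summable_noiseSeries (hL : Summable fun j => ‖L ^ j‖) (hν : MemLp id p ν) :
    ∀ᵐ ω ∂(Measure.infinitePi fun _ : ℕ => ν), Summable fun j => (L ^ j) (ω j) := by
  filter_upwards [summable_norm_of_tsum_eLpNorm_ne_top Fact.out
    (fun j => (memLp_pow_eval hν j).aestronglyMeasurable) (tsum_eLpNorm_pow_eval_ne_top hL hν)]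
    with ω hω using hω.of_norm

theorem memLp_noiseSeries (hL : Summable fun j => ‖L ^ j‖) (hν : MemLp id p ν) :
    MemLp (noiseSeries L) p (Measure.infinitePi fun _ => ν) := by
  have hsum : ∑' j, ‖(memLp_pow_eval (L := L) hν j).toLp‖ₑ ≠ ⊤ := by
    simpa only [Lp.enorm_toLp] using tsum_eLpNorm_pow_eval_ne_top hL hν
  refine (memLp_congr_ae ?_).1 (Lp.memLp (∑' j, (memLp_pow_eval (L := L) hν j).toLp))
  filter_upwards [Lp.hasSum_coeFn_tsum hsum,
    ae_all_iff.2 fun j => (memLp_pow_eval (L := L) hν j).coeFn_toLp] with ω hω hcoe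
  simp only [hcoe] at hω
  exact hω.tsum_eq.symm

variable [BorelSpace E] [SecondCountableTopology E]

theorem measurable_noiseSeries : Measurable (noiseSeries L) :=
  Measurable.tsum fun j => (L ^ j).measurable.comp (measurable_pi_apply j)

theorem indepFun_noiseSeries_shift :
    IndepFun (fun ω : ℕ → E => noiseSeries L fun j => ω (j + 1)) (fun ω => ω 0)
      (Measure.infinitePi fun _ => ν) := by
  have hiid : iIndepFun (fun (i : ℕ) (ω : ℕ → E) => ω i) (Measure.infinitePi fun _ => ν) :=
    iIndepFun_infinitePi (P := fun _ : ℕ => ν) (X := fun _ x => x) fun _ => measurable_id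
  exact (indepFun_tail_of_iIndepFun hiid measurable_pi_apply 0).symm.comp
    measurable_noiseSeries measurable_id

theorem exists_invariant_law_of_summable_norm_pow (hL : Summable fun j => ‖L ^ j‖)
    (hν : MemLp id p ν) :
    ∃ ρ : Measure E, IsProbabilityMeasure ρ ∧ MemLp id p ρ ∧
      (ρ.prod ν).map (fun q => L q.1 + q.2) = ρ := by
  let shift : (ℕ → E) → ℕ → E := fun ω j => ω (j + 1)
  have hshift : Measurable shift := by fun_prop
  have hΦ : Measurable (noiseSeries L) := measurable_noiseSeries
  have hmap_shift :
      (Measure.infinitePi fun _ : ℕ => ν).map shift = Measure.infinitePi fun _ => ν :=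
    Measure.map_infinitePi_infinitePi_of_inj (P := fun _ : ℕ => ν) (add_left_injective 1)
  refine ⟨(Measure.infinitePi fun _ => ν).map (noiseSeries L),
    Measure.isProbabilityMeasure_map hΦ.aemeasurable,
    (memLp_map_measure_iff aestronglyMeasurable_id hΦ.aemeasurable).2
      (memLp_noiseSeries hL hν), ?_⟩
  have hprod : ((Measure.infinitePi fun _ => ν).map (noiseSeries L)).prod ν
      = (Measure.infinitePi fun _ => ν).map fun ω => (noiseSeries L (shift ω), ω 0) := by
    refine Eq.trans ?_ ((indepFun_iff_map_prod_eq_prod_map_map (hΦ.comp hshift).aemeasurable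
      (measurable_pi_apply 0).aemeasurable).1 indepFun_noiseSeries_shift).symm
    congr 1
    · conv_lhs => rw [← hmap_shift, Measure.map_map hΦ hshift]
    · exact (Measure.infinitePi_map_eval (fun _ : ℕ => ν) 0).symm
  have hsummable := ae_summable_noiseSeries hL hν
  have hsummable_shift := hsummable
  rw [← hmap_shift] at hsummable_shift
  have hpair : Measurable fun ω : ℕ → E => (noiseSeries L (shift ω), ω 0) :=
    (hΦ.comp hshift).prodMk (measurable_pi_apply 0)
  rw [hprod, Measure.map_map (by fun_prop) hpair]
  refine Measure.map_congr ?_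
  filter_upwards [hsummable, ae_of_ae_map hshift.aemeasurable hsummable_shift] with ω hω hω'
  exact (noiseSeries_eq_add hω hω').symm

end InvariantLaw

section Contraction

variable {n : ℕ} {M T : Matrix (Fin n) (Fin n) ℝ}

theorem sq_norm_le_sqNorm (x : Fin n → ℝ) : ‖x‖ ^ 2 ≤ sqNorm x := by
  rw [← Real.le_sqrt (norm_nonneg _) (sqNorm_nonneg _)]
  refine (pi_norm_le_iff_of_nonneg (Real.sqrt_nonneg _)).2 fun i => ?_
  rw [Real.norm_eq_abs, ← Real.sqrt_sq_eq_abs, sqNorm_eq_sum]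
  exact Real.sqrt_le_sqrt (Finset.single_le_sum (f := fun i => x i ^ 2)
    (fun _ _ => sq_nonneg _) (Finset.mem_univ i))

theorem sqNorm_le_mul_sq_norm (x : Fin n → ℝ) : sqNorm x ≤ n * ‖x‖ ^ 2 := by
  rw [sqNorm_eq_sum]
  refine (Finset.sum_le_card_nsmul _ _ (‖x‖ ^ 2) fun i _ => ?_).trans (by simp)
  rw [← sq_abs]
  exact pow_le_pow_left₀ (abs_nonneg _) (norm_le_pi_norm x i) 2

theorem exists_quadForm_pow_mulVec_le {c : ℝ} (hc : 0 < c)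
    (hTM : ∀ x, quadForm T (M *ᵥ x) + c * sqNorm x ≤ quadForm T x) :
    ∃ θ : ℝ, 0 ≤ θ ∧ θ < 1 ∧ ∀ j x, quadForm T (M ^ j *ᵥ x) ≤ θ ^ j * quadForm T x := by
  obtain ⟨C, hC, hTC⟩ := exists_quadForm_le_mul_sqNorm T
  have hstep (x) : quadForm T (M *ᵥ x) ≤ C / (C + c) * quadForm T x := by
    have hdecay := mul_le_mul_of_nonneg_left (hTM x) (add_pos hC hc).le
    have hbound := mul_le_mul_of_nonneg_left (hTC x) hc.le
    have hsq := mul_nonneg (mul_pos hc hc).le (sqNorm_nonneg x)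
    rw [div_mul_eq_mul_div, le_div_iff₀ (by positivity)]
    linarith
  refine ⟨C / (C + c), by positivity, by rw [div_lt_one (by positivity)]; linarith, fun j => ?_⟩
  induction j with
  | zero => simp
  | succ j ih =>
    intro x
    rw [pow_succ, ← Matrix.mulVec_mulVec, pow_succ, mul_assoc]
    exact (ih _).trans (mul_le_mul_of_nonneg_left (hstep x) (by positivity))

theorem toContinuousLinearMap_pow_apply (M : Matrix (Fin n) (Fin n) ℝ) (j : ℕ) (x : Fin n → ℝ) :
    ((LinearMap.toContinuousLinearMap M.mulVecLin) ^ j) x = M ^ j *ᵥ x := by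
  induction j generalizing x with
  | zero => rw [pow_zero, pow_zero, Matrix.one_mulVec, one_apply_eq_self]
  | succ j ih => rw [pow_succ, pow_succ, mul_apply_eq_comp, ih]; simp

theorem summable_norm_pow_toContinuousLinearMap (hT : T.PosDef) {c : ℝ} (hc : 0 < c)
    (hTM : ∀ x, quadForm T (M *ᵥ x) + c * sqNorm x ≤ quadForm T x) :
    Summable fun j => ‖(LinearMap.toContinuousLinearMap M.mulVecLin) ^ j‖ := by
  obtain ⟨θ, hθ, hθ_lt, hpow⟩ := exists_quadForm_pow_mulVec_le hc hTM
  obtain ⟨r, hr, hrT⟩ := exists_mul_sqNorm_le_quadForm hT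
  obtain ⟨C, hC, hTC⟩ := exists_quadForm_le_mul_sqNorm T
  refine Summable.of_nonneg_of_le (fun _ => norm_nonneg _)
    (f := fun j => √(C * n / r) * √θ ^ j) (fun j => ?_)
    ((summable_geometric_of_lt_one (Real.sqrt_nonneg _)
      ((Real.sqrt_lt' one_pos).2 (by simpa using hθ_lt))).mul_left _)
  refine ContinuousLinearMap.opNorm_le_bound _ (by positivity) fun x => ?_
  rw [toContinuousLinearMap_pow_apply]
  refine (abs_le_of_sq_le_sq' ?_ (by positivity)).2
  calc ‖M ^ j *ᵥ x‖ ^ 2 ≤ r⁻¹ * quadForm T (M ^ j *ᵥ x) := by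
        rw [← div_eq_inv_mul, le_div_iff₀ hr, mul_comm]
        exact (mul_le_mul_of_nonneg_left (sq_norm_le_sqNorm _) hr.le).trans (hrT _)
    _ ≤ r⁻¹ * (θ ^ j * (C * (n * ‖x‖ ^ 2))) := by
        gcongr
        exact (hpow j x).trans (mul_le_mul_of_nonneg_left ((hTC x).trans
          (mul_le_mul_of_nonneg_left (sqNorm_le_mul_sq_norm x) hC.le)) (by positivity))
    _ = (√(C * n / r) * √θ ^ j * ‖x‖) ^ 2 := by
        rw [mul_pow, mul_pow, Real.sq_sqrt (by positivity), ← pow_mul, mul_comm j 2, pow_mul,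
          Real.sq_sqrt hθ]
        ring

end Contraction

section Dissipation

namespace LQData

variable {n l m : ℕ} {D : LQData n l m} {Ω : Type*} [MeasurableSpace Ω] {μ : Measure Ω}
  {P S : Matrix (Fin n) (Fin n) ℝ} {w : Fin m → ℝ} {xe : Fin n → ℝ} {ue : Fin l → ℝ}
  {p xs xt : Fin n → ℝ} {x y : Ω → Fin n → ℝ} {u : Ω → Fin l → ℝ} {v : Ω → Fin m → ℝ}
  {Xs : ℕ → Ω → Fin n → ℝ} {k : ℕ}

/-- The definiteness conditions on the weights of the stage cost. -/
structure HasDefiniteWeights (D : LQData n l m) : Prop where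
  posSemidef_Q₁ : D.Q₁.PosSemidef
  posSemidef_Q₂ : D.Q₂.PosSemidef
  posDef_R₁ : D.R₁.PosDef
  posSemidef_R₂ : D.R₂.PosSemidef

/-- `S` is a quadratic storage function with dissipation rate `c` for the noise-free linear system
`x ↦ A x + B u` and the supply rate given by `Q₁` and `R₁`. -/
def IsStrictStorageMatrix (D : LQData n l m) (S : Matrix (Fin n) (Fin n) ℝ) (c : ℝ) : Prop :=
  ∀ x u, c * sqNorm x + quadForm S (D.A *ᵥ x + D.B *ᵥ u)
    ≤ quadForm D.Q₁ x + quadForm D.R₁ u + quadForm S x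

theorem HasDefiniteWeights.posSemidef_state (hD : D.HasDefiniteWeights) :
    (D.Q₁ + D.Q₂).PosSemidef :=
  hD.posSemidef_Q₁.add hD.posSemidef_Q₂

theorem HasDefiniteWeights.posDef_control (hD : D.HasDefiniteWeights) : (D.R₁ + D.R₂).PosDef :=
  hD.posDef_R₁.add_posSemidef hD.posSemidef_R₂

/-- Deviations `x`, `u`, `v` of state, control and noise from a steady state at one time: the noise
is centred, and independent of the state and of the control. -/
structure IsCentredStep (μ : Measure Ω) (x : Ω → Fin n → ℝ) (u : Ω → Fin l → ℝ)
    (v : Ω → Fin m → ℝ) : Prop where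
  memLp_state : MemLp x 2 μ
  memLp_control : MemLp u 2 μ
  memLp_noise : MemLp v 2 μ
  indep_state : IndepFun v x μ
  indep_control : IndepFun v u μ
  mean_noise : ∫ ω, v ω ∂μ = 0

theorem memLp_mulVec_add_mulVec (hx : MemLp x 2 μ) (hu : MemLp u 2 μ) :
    MemLp (fun ω => D.A *ᵥ x ω + D.B *ᵥ u ω) 2 μ :=
  (memLp_mulVec D.A hx).add (memLp_mulVec D.B hu)

theorem IsCentredStep.memLp_linearStep (h : IsCentredStep μ x u v) :
    MemLp (fun ω => D.linearStep (x ω) (u ω) (v ω)) 2 μ :=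
  D.memLp_linearStep h.memLp_state h.memLp_control h.memLp_noise

theorem integral_quadForm_step_add (hR : (D.R₁ + D.R₂).PosDef) (hP : P.PosSemidef)
    (hRic : D.IsRiccatiSolution P) (hx : MemLp x 2 μ) (hu : MemLp u 2 μ) :
    ∫ ω, quadForm P (D.A *ᵥ x ω + D.B *ᵥ u ω) ∂μ + ∫ ω, quadForm (D.Q₁ + D.Q₂) (x ω) ∂μ
        + ∫ ω, quadForm (D.R₁ + D.R₂) (u ω) ∂μ
      = ∫ ω, quadForm P (x ω) ∂μ
        + ∫ ω, quadForm (D.R₁ + D.R₂ + D.Bᵀ * P * D.B) (u ω - D.gain P *ᵥ x ω) ∂μ := by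
  have hstep := integrable_quadForm P (memLp_mulVec_add_mulVec (D := D) hx hu)
  have hQx := integrable_quadForm (D.Q₁ + D.Q₂) hx
  have hdev : MemLp (fun ω => u ω - D.gain P *ᵥ x ω) 2 μ := hu.sub (memLp_mulVec (D.gain P) hx)
  have hgap := integrable_quadForm (D.R₁ + D.R₂ + D.Bᵀ * P * D.B) hdev
  have hbellman (ω) := bellman_eq (A := D.A) (B := D.B) (Q := D.Q₁ + D.Q₂) hR hP (x ω) (u ω)
  have hfixed : riccatiMap D.A D.B (D.Q₁ + D.Q₂) (D.R₁ + D.R₂) P = P := hRic.symm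
  simp only [hfixed] at hbellman
  rw [← integral_add hstep hQx, ← integral_add (hstep.fun_add hQx) (integrable_quadForm _ hu),
    ← integral_add (integrable_quadForm P hx) hgap]
  exact integral_congr_ae (Eventually.of_forall hbellman)

variable [IsProbabilityMeasure μ]

theorem stageCost_eq_integral (hx : MemLp x 2 μ) (hu : MemLp u 2 μ) :
    D.stageCost μ x u
      = ∫ ω, quadForm (D.Q₁ + D.Q₂) (x ω) ∂μ + ∫ ω, quadForm (D.R₁ + D.R₂) (u ω) ∂μ
        - quadForm D.Q₂ (∫ ω, x ω ∂μ) - quadForm D.R₂ (∫ ω, u ω ∂μ)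
        + (D.s ⬝ᵥ ∫ ω, x ω ∂μ) + (D.v ⬝ᵥ ∫ ω, u ω ∂μ) + D.c := by
  have hx₁ := hx.integrable one_le_two
  have hu₁ := hu.integrable one_le_two
  have hQ := integrable_quadForm D.Q₁ hx
  have hR := integrable_quadForm D.R₁ hu
  have hs := integrable_const_dotProduct D.s hx₁
  have hv := integrable_const_dotProduct D.v hu₁
  simp only [quadForm_add_matrix]
  rw [stageCost, trace_mul_covMatrix _ hx, trace_mul_covMatrix _ hu,
    integral_add (((hQ.fun_add hR).fun_add hs).fun_add hv) (integrable_const _),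
    integral_add ((hQ.fun_add hR).fun_add hs) hv, integral_add (hQ.fun_add hR) hs,
    integral_add hQ hR, integral_const_dotProduct _ hx₁, integral_const_dotProduct _ hu₁,
    integral_add hQ (integrable_quadForm D.Q₂ hx), integral_add hR (integrable_quadForm D.R₂ hu)]
  simp only [integral_const, probReal_univ, one_smul]
  ring

theorem IsOptimalSteadyState.stageCost_add_const (he : D.IsOptimalSteadyState w xe ue p)
    (hD : D.HasDefiniteWeights) (hx : MemLp x 2 μ) (hu : MemLp u 2 μ) :
    D.stageCost μ (fun ω => x ω + xe) (fun ω => u ω + ue)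
      = ∫ ω, quadForm (D.Q₁ + D.Q₂) (x ω) ∂μ + ∫ ω, quadForm (D.R₁ + D.R₂) (u ω) ∂μ
        - quadForm D.Q₂ (∫ ω, x ω ∂μ) - quadForm D.R₂ (∫ ω, u ω ∂μ)
        + p ⬝ᵥ (D.A *ᵥ (∫ ω, x ω ∂μ) + D.B *ᵥ (∫ ω, u ω ∂μ) - ∫ ω, x ω ∂μ)
        + (quadForm D.Q₁ xe + quadForm D.R₁ ue + D.s ⬝ᵥ xe + D.v ⬝ᵥ ue + D.c) := by
  have hQ₁ := isSymm_of_posSemidef hD.posSemidef_Q₁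
  have hQ₂ := isSymm_of_posSemidef hD.posSemidef_Q₂
  have hR₁ := isSymm_of_posSemidef hD.posDef_R₁.posSemidef
  have hR₂ := isSymm_of_posSemidef hD.posSemidef_R₂
  have hX : MemLp (fun ω => x ω + xe) 2 μ := hx.add (memLp_const _)
  have hU : MemLp (fun ω => u ω + ue) 2 μ := hu.add (memLp_const _)
  have hstat := he.stationary (∫ ω, x ω ∂μ) (∫ ω, u ω ∂μ)
  rw [stageCost_eq_integral hX hU,
    integral_quadForm_add_const (hQ₁.add hQ₂) hx, integral_quadForm_add_const (hR₁.add hR₂) hu,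
    integral_add (hx.integrable one_le_two) (integrable_const _),
    integral_add (hu.integrable one_le_two) (integrable_const _)]
  simp only [integral_const, probReal_univ, one_smul, quadForm_add hQ₂, quadForm_add hR₂,
    quadForm_add_matrix, Matrix.add_mulVec, add_dotProduct, dotProduct_add, dotProduct_sub]
    at hstat ⊢
  rw [dotProduct_comm (D.Q₁ *ᵥ xe), dotProduct_comm (D.Q₂ *ᵥ xe), dotProduct_comm (D.R₁ *ᵥ ue),
    dotProduct_comm (D.R₂ *ᵥ ue), dotProduct_mulVec_comm hQ₁ _ xe,
    dotProduct_mulVec_comm hR₁ _ ue]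
  linarith

theorem IsCentredStep.integral_quadForm_linearStep (h : IsCentredStep μ x u v) (hP : P.IsSymm) :
    ∫ ω, quadForm P (D.linearStep (x ω) (u ω) (v ω)) ∂μ
      = ∫ ω, quadForm P (D.A *ᵥ x ω + D.B *ᵥ u ω) ∂μ + ∫ ω, quadForm P (D.E *ᵥ v ω) ∂μ := by
  have hEv := memLp_mulVec D.E h.memLp_noise
  have hPE := memLp_mulVec P hEv
  have hPE_mean := integral_mulVec_eq_zero P (hEv.integrable one_le_two)
    (integral_mulVec_eq_zero D.E (h.memLp_noise.integrable one_le_two) h.mean_noise)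
  have hcross {d : ℕ} {z : Ω → Fin d → ℝ} (N : Matrix (Fin n) (Fin d) ℝ) (hz : MemLp z 2 μ)
      (hvz : IndepFun v z μ) : ∫ ω, (N *ᵥ z ω) ⬝ᵥ (P *ᵥ D.E *ᵥ v ω) ∂μ = 0 := by
    rw [integral_dotProduct_of_indepFun _ (memLp_mulVec N hz) hPE, hPE_mean, dotProduct_zero]
    exact hvz.symm.comp (φ := fun a => N *ᵥ a) (ψ := fun a => P *ᵥ D.E *ᵥ a)
      (Continuous.measurable (by fun_prop)) (Continuous.measurable (by fun_prop))
  simp only [linearStep]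
  rw [integral_quadForm_add hP (memLp_mulVec_add_mulVec h.memLp_state h.memLp_control) hEv]
  simp only [add_dotProduct]
  rw [integral_add (integrable_dotProduct (memLp_mulVec D.A h.memLp_state) hPE)
    (integrable_dotProduct (memLp_mulVec D.B h.memLp_control) hPE),
    hcross D.A h.memLp_state h.indep_state, hcross D.B h.memLp_control h.indep_control]
  ring

/-- The Bellman identity turns both costs into the decrease of `P` along the dynamics, up to the
deviation of the control from the optimal feedback; the noise contributes equally to both. -/
theorem IsOptimalSteadyState.stageCost_sub_stageCost (he : D.IsOptimalSteadyState w xe ue p)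
    (hD : D.HasDefiniteWeights) (hP : P.PosSemidef) (hRic : D.IsRiccatiSolution P)
    (hxu : IsCentredStep μ x u v) (hy : IsCentredStep μ y (fun ω => D.gain P *ᵥ y ω) v)
    (hy_mean : ∫ ω, y ω ∂μ = 0)
    (hstat : ∫ ω, quadForm P (D.linearStep (y ω) (D.gain P *ᵥ y ω) (v ω)) ∂μ
      = ∫ ω, quadForm P (y ω) ∂μ) :
    D.stageCost μ (fun ω => x ω + xe) (fun ω => u ω + ue)
        - D.stageCost μ (fun ω => y ω + xe) (fun ω => D.gain P *ᵥ y ω + ue)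
      = ∫ ω, quadForm P (x ω) ∂μ - ∫ ω, quadForm P (D.linearStep (x ω) (u ω) (v ω)) ∂μ
        + ∫ ω, quadForm (D.R₁ + D.R₂ + D.Bᵀ * P * D.B) (u ω - D.gain P *ᵥ x ω) ∂μ
        - quadForm D.Q₂ (∫ ω, x ω ∂μ) - quadForm D.R₂ (∫ ω, u ω ∂μ)
        + p ⬝ᵥ (D.A *ᵥ (∫ ω, x ω ∂μ) + D.B *ᵥ (∫ ω, u ω ∂μ) - ∫ ω, x ω ∂μ) := by
  have hKy_mean := integral_mulVec_eq_zero (D.gain P) (hy.memLp_state.integrable one_le_two) hy_mean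
  have hPsymm := isSymm_of_posSemidef hP
  have hbellman := integral_quadForm_step_add hD.posDef_control hP hRic
    hxu.memLp_state hxu.memLp_control
  have hbellman_opt := integral_quadForm_step_add hD.posDef_control hP hRic
    hy.memLp_state hy.memLp_control
  have hnoise := hxu.integral_quadForm_linearStep (D := D) hPsymm
  have hnoise_opt := hy.integral_quadForm_linearStep (D := D) hPsymm
  rw [he.stageCost_add_const hD hxu.memLp_state hxu.memLp_control,
    he.stageCost_add_const hD hy.memLp_state hy.memLp_control, hy_mean, hKy_mean]
  simp only [sub_self, quadForm_zero, integral_zero, Matrix.mulVec_zero, add_zero,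
    dotProduct_zero] at hbellman_opt ⊢
  linarith

theorem storage_add_const (hP : P.IsSymm) (hS : S.IsSymm) (hx : MemLp x 2 μ) (hy : MemLp y 2 μ)
    (hy_mean : ∫ ω, y ω ∂μ = 0) (hXs : Xs k = fun ω => y ω + (xt + xs)) :
    storage μ P S (p - (2 : ℝ) • (S *ᵥ xt)) xs xt Xs k (fun ω => x ω + (xt + xs))
      = ∫ ω, quadForm (P + S) (x ω - y ω) ∂μ - ∫ ω, quadForm P (x ω) ∂μ
        + (p ⬝ᵥ ∫ ω, x ω ∂μ) + (p ⬝ᵥ xt - quadForm S xt) := by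
  have hxy : MemLp (fun ω => x ω - y ω) 2 μ := hx.sub hy
  have hdev : MemLp (fun ω => x ω - y ω + xt) 2 μ := hxy.add (memLp_const _)
  have hshift : MemLp (fun ω => x ω + xt) 2 μ := hx.add (memLp_const _)
  have hdev_eq (ω) : x ω + (xt + xs) - (y ω + (xt + xs) - xt) = x ω - y ω + xt := by abel
  have hshift_eq (ω) : x ω + (xt + xs) - xs = x ω + xt := by abel
  have hdev₁ := hdev.integrable one_le_two
  simp only [storage, hXs, hdev_eq, hshift_eq]
  have hPS := integrable_quadForm (P + S) hdev
  have hPshift := integrable_quadForm P hshift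
  have hdiff : Integrable
      (fun ω => quadForm (P + S) (x ω - y ω + xt) - quadForm P (x ω + xt)) μ := hPS.sub hPshift
  rw [integral_add hdiff (integrable_const_dotProduct _ hdev₁),
    integral_sub hPS hPshift,
    integral_const_dotProduct _ hdev₁, integral_quadForm_add_const (hP.add hS) hxy,
    integral_quadForm_add_const hP hx, integral_add (hxy.integrable one_le_two)
      (integrable_const _),
    integral_sub_eq_left (hx.integrable one_le_two) (hy.integrable one_le_two) hy_mean]
  simp only [integral_const, probReal_univ, one_smul, Matrix.add_mulVec,
    add_dotProduct, sub_dotProduct, dotProduct_add, smul_dotProduct, smul_eq_mul, quadForm,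
    dotProduct_comm (S *ᵥ xt) xt]
  ring

theorem IsCentredStep.integral_linearStep (h : IsCentredStep μ x u v) :
    ∫ ω, D.linearStep (x ω) (u ω) (v ω) ∂μ
      = D.A *ᵥ (∫ ω, x ω ∂μ) + D.B *ᵥ (∫ ω, u ω ∂μ) := by
  rw [D.integral_linearStep (h.memLp_state.integrable one_le_two)
    (h.memLp_control.integrable one_le_two) (h.memLp_noise.integrable one_le_two), h.mean_noise,
    linearStep, Matrix.mulVec_zero, add_zero]

theorem IsOptimalSteadyState.dissipation_eq (he : D.IsOptimalSteadyState w (xt + xs) ue p)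
    (hD : D.HasDefiniteWeights) (hP : P.PosSemidef) (hRic : D.IsRiccatiSolution P) (hS : S.IsSymm)
    (hxu : IsCentredStep μ x u v) (hy : IsCentredStep μ y (fun ω => D.gain P *ᵥ y ω) v)
    (hy_mean : ∫ ω, y ω ∂μ = 0)
    (hstat : ∫ ω, quadForm P (D.linearStep (y ω) (D.gain P *ᵥ y ω) (v ω)) ∂μ
      = ∫ ω, quadForm P (y ω) ∂μ)
    (hXs : Xs k = fun ω => y ω + (xt + xs))
    (hXs_succ : Xs (k + 1) = fun ω =>
      D.linearStep (y ω) (D.gain P *ᵥ y ω) (v ω) + (xt + xs)) :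
    D.stageCost μ (fun ω => x ω + (xt + xs)) (fun ω => u ω + ue)
        - D.stageCost μ (fun ω => y ω + (xt + xs)) (fun ω => D.gain P *ᵥ y ω + ue)
        + storage μ P S (p - (2 : ℝ) • (S *ᵥ xt)) xs xt Xs k (fun ω => x ω + (xt + xs))
        - storage μ P S (p - (2 : ℝ) • (S *ᵥ xt)) xs xt Xs (k + 1)
            (fun ω => D.linearStep (x ω) (u ω) (v ω) + (xt + xs))
      = ∫ ω, quadForm (D.Q₁ + D.Q₂) (x ω - y ω) ∂μ
        + ∫ ω, quadForm (D.R₁ + D.R₂) (u ω - D.gain P *ᵥ y ω) ∂μ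
        + ∫ ω, quadForm S (x ω - y ω) ∂μ
        - ∫ ω, quadForm S (D.A *ᵥ (x ω - y ω) + D.B *ᵥ (u ω - D.gain P *ᵥ y ω)) ∂μ
        - quadForm D.Q₂ (∫ ω, (x ω - y ω) ∂μ)
        - quadForm D.R₂ (∫ ω, (u ω - D.gain P *ᵥ y ω) ∂μ) := by
  have hξ : MemLp (fun ω => x ω - y ω) 2 μ := hxu.memLp_state.sub hy.memLp_state
  have hη : MemLp (fun ω => u ω - D.gain P *ᵥ y ω) 2 μ := hxu.memLp_control.sub hy.memLp_control
  have hKy_mean := integral_mulVec_eq_zero (D.gain P) (hy.memLp_state.integrable one_le_two) hy_mean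
  have hnext_mean : ∫ ω, D.linearStep (y ω) (D.gain P *ᵥ y ω) (v ω) ∂μ = 0 := by
    rw [hy.integral_linearStep, hy_mean, hKy_mean, Matrix.mulVec_zero, Matrix.mulVec_zero, add_zero]
  have hgain (ω) : u ω - D.gain P *ᵥ y ω - D.gain P *ᵥ (x ω - y ω) = u ω - D.gain P *ᵥ x ω := by
    rw [Matrix.mulVec_sub]
    abel
  have hbellman := integral_quadForm_step_add hD.posDef_control hP hRic hξ hη
  have hPsymm := isSymm_of_posSemidef hP
  have hstep := memLp_mulVec_add_mulVec (D := D) hξ hη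
  rw [he.stageCost_sub_stageCost hD hP hRic hxu hy hy_mean hstat,
    storage_add_const hPsymm hS hxu.memLp_state hy.memLp_state hy_mean hXs,
    storage_add_const hPsymm hS hxu.memLp_linearStep hy.memLp_linearStep hnext_mean hXs_succ,
    hxu.integral_linearStep,
    integral_sub_eq_left (hxu.memLp_state.integrable one_le_two)
      (hy.memLp_state.integrable one_le_two) hy_mean,
    integral_sub_eq_left (hxu.memLp_control.integrable one_le_two)
      (hy.memLp_control.integrable one_le_two) hKy_mean]
  simp only [hgain] at hbellman
  simp only [linearStep_sub_linearStep, quadForm_add_matrix P S, dotProduct_sub]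
  rw [integral_add (integrable_quadForm P hξ) (integrable_quadForm S hξ),
    integral_add (integrable_quadForm P hstep) (integrable_quadForm S hstep)]
  linarith

theorem HasDefiniteWeights.mul_integral_sqNorm_le (hD : D.HasDefiniteWeights) {c : ℝ}
    (hS : D.IsStrictStorageMatrix S c) (hx : MemLp x 2 μ) (hu : MemLp u 2 μ) :
    c * ∫ ω, sqNorm (x ω) ∂μ ≤
      ∫ ω, quadForm (D.Q₁ + D.Q₂) (x ω) ∂μ + ∫ ω, quadForm (D.R₁ + D.R₂) (u ω) ∂μ
        + ∫ ω, quadForm S (x ω) ∂μ - ∫ ω, quadForm S (D.A *ᵥ x ω + D.B *ᵥ u ω) ∂μ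
        - quadForm D.Q₂ (∫ ω, x ω ∂μ) - quadForm D.R₂ (∫ ω, u ω ∂μ) := by
  have hnorm : Integrable (fun ω => c * sqNorm (x ω)) μ := (integrable_dotProduct hx hx).const_mul c
  have hstep := integrable_quadForm S (memLp_mulVec_add_mulVec (D := D) hx hu)
  have hQ₁ := integrable_quadForm D.Q₁ hx
  have hR₁ := integrable_quadForm D.R₁ hu
  have hmono := integral_mono (hnorm.fun_add hstep)
    ((hQ₁.fun_add hR₁).fun_add (integrable_quadForm S hx)) fun ω => hS (x ω) (u ω)
  rw [integral_add hnorm hstep, integral_add (hQ₁.fun_add hR₁) (integrable_quadForm S hx),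
    integral_add hQ₁ hR₁, integral_const_mul] at hmono
  simp only [quadForm_add_matrix]
  rw [integral_add hQ₁ (integrable_quadForm D.Q₂ hx),
    integral_add hR₁ (integrable_quadForm D.R₂ hu)]
  linarith [quadForm_integral_le hD.posSemidef_Q₂ hx, quadForm_integral_le hD.posSemidef_R₂ hu]

theorem le_quadForm_add_sub_quadForm_add {r : ℝ} (hr : 0 < r) (hP : P.IsSymm)
    (hS : ∀ a, r * sqNorm a ≤ quadForm S a) (q g b : Fin n → ℝ) :
    quadForm (-(2 / r) • (Pᵀ * P) - P) b - (2 * r)⁻¹ * sqNorm q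
      ≤ quadForm (P + S) g - quadForm P (g + b) + q ⬝ᵥ g := by
  have hcross := two_mul_dotProduct_le (half_pos hr) g (P *ᵥ b)
  have hlinear := two_mul_dotProduct_le hr g (-q)
  have hneg : sqNorm (-q) = sqNorm q := neg_dotProduct_neg q q
  rw [dotProduct_neg, dotProduct_comm g q, hneg] at hlinear
  rw [inv_div] at hcross
  simp only [quadForm_add_matrix, quadForm_sub_matrix, quadForm_smul_matrix,
    quadForm_transpose_mul_self, quadForm_add hP, mul_inv]
  linarith [hS g]

theorem exists_le_storage (hP : P.IsSymm) (hS : S.PosDef) (q xs xt : Fin n → ℝ)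
    (hXs : ∀ k, MemLp (Xs k) 2 μ)
    (hstat : ∀ k (M : Matrix (Fin n) (Fin n) ℝ),
      ∫ ω, quadForm M (Xs k ω - (xt + xs)) ∂μ = ∫ ω, quadForm M (Xs 0 ω - (xt + xs)) ∂μ) :
    ∃ C : ℝ, ∀ k, ∀ X : Ω → Fin n → ℝ, MemLp X 2 μ → C ≤ storage μ P S q xs xt Xs k X := by
  obtain ⟨r, hr, hrS⟩ := exists_mul_sqNorm_le_quadForm hS
  set M := -(2 / r) • (Pᵀ * P) - P
  refine ⟨∫ ω, (quadForm M (Xs 0 ω - (xt + xs))) ∂μ - (2 * r)⁻¹ * sqNorm q, fun k X hX => ?_⟩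
  have hy : MemLp (fun ω => Xs k ω - (xt + xs)) 2 μ := (hXs k).sub (memLp_const _)
  have hdev : MemLp (fun ω => X ω - (Xs k ω - xt)) 2 μ := hX.sub ((hXs k).sub (memLp_const _))
  have hshift : MemLp (fun ω => X ω - xs) 2 μ := hX.sub (memLp_const _)
  have hM := integrable_quadForm M hy
  have hPS := integrable_quadForm (P + S) hdev
  have hPshift := integrable_quadForm P hshift
  have hq := integrable_const_dotProduct q (hdev.integrable one_le_two)
  calc ∫ ω, quadForm M (Xs 0 ω - (xt + xs)) ∂μ - (2 * r)⁻¹ * sqNorm q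
      = ∫ ω, (quadForm M (Xs k ω - (xt + xs)) - (2 * r)⁻¹ * sqNorm q) ∂μ := by
        rw [integral_sub hM (integrable_const _), hstat k, integral_const, probReal_univ, one_smul]
    _ ≤ storage μ P S q xs xt Xs k X := by
        refine integral_mono (hM.sub (integrable_const _)) ((hPS.sub hPshift).add hq) fun ω => ?_
        have hsplit : X ω - xs = (X ω - (Xs k ω - xt)) + (Xs k ω - (xt + xs)) := by abel
        simpa only [hsplit] using le_quadForm_add_sub_quadForm_add hr hP hrS q _ _

end LQData

end Dissipation

section ClosedLoop

theorem isP2_iff_memLp {d : ℕ} {ρ : Measure (Fin d → ℝ)} :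
    IsP2 ρ ↔ IsProbabilityMeasure ρ ∧ MemLp id 2 ρ :=
  and_congr_right fun _ => (memLp_two_iff_integrable_sqNorm aestronglyMeasurable_id).symm

theorem isP2_map {d e : ℕ} {ρ : Measure (Fin d → ℝ)} [IsProbabilityMeasure ρ]
    {g : (Fin d → ℝ) → Fin e → ℝ} (hg : MemLp g 2 ρ) : IsP2 (ρ.map g) :=
  isP2_iff_memLp.2 ⟨Measure.isProbabilityMeasure_map hg.aemeasurable,
    (memLp_map_measure_iff aestronglyMeasurable_id hg.aemeasurable).2 hg⟩

theorem memLp_of_hasLaw {Ω : Type*} [MeasurableSpace Ω] {μ : Measure Ω} {d : ℕ}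
    {X : Ω → Fin d → ℝ} {ρ : Measure (Fin d → ℝ)} (hρ : IsP2 ρ) (hX : HasLaw X ρ μ) :
    MemLp X 2 μ :=
  (memLp_map_measure_iff aestronglyMeasurable_id hX.aemeasurable).1
    (hX.map_eq ▸ (isP2_iff_memLp.1 hρ).2)

namespace LQData

variable {n l m : ℕ} (D : LQData n l m) {P S : Matrix (Fin n) (Fin n) ℝ} {xe : Fin n → ℝ}
  {ue : Fin l → ℝ} {w : Fin m → ℝ}

/-- The system matrix `A + B K` of the closed loop under the feedback gain `K` of `P`. -/
noncomputable def closedLoopMatrix (P : Matrix (Fin n) (Fin n) ℝ) : Matrix (Fin n) (Fin n) ℝ :=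
  D.A + D.B * D.gain P

theorem closedLoopMatrix_mulVec (P : Matrix (Fin n) (Fin n) ℝ) (x : Fin n → ℝ) :
    D.closedLoopMatrix P *ᵥ x = D.A *ᵥ x + D.B *ᵥ D.gain P *ᵥ x := by
  rw [closedLoopMatrix, Matrix.add_mulVec, Matrix.mulVec_mulVec]

theorem f_feedback (P : Matrix (Fin n) (Fin n) ℝ) (xe : Fin n → ℝ) (ue : Fin l → ℝ)
    (x : Fin n → ℝ) (w : Fin m → ℝ) :
    D.f x (D.feedback P xe ue x) w
      = D.closedLoopMatrix P *ᵥ x + D.f 0 (D.feedback P xe ue 0) w := by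
  simp only [f, feedback, closedLoopMatrix_mulVec, Matrix.mulVec_add, Matrix.mulVec_sub,
    Matrix.mulVec_zero]
  abel

variable {D} in
theorem f_eq_linearStep_add (hsteady : D.f xe ue w = xe) (x : Fin n → ℝ) (u : Fin l → ℝ)
    (w' : Fin m → ℝ) :
    D.f x u w' = D.linearStep (x - xe) (u - ue) (w' - w) + xe := by
  have hshift := D.f_add (x - xe) xe (u - ue) ue (w' - w) w
  simpa only [sub_add_cancel, hsteady] using hshift

variable {D} in
theorem HasDefiniteWeights.quadForm_closedLoopMatrix_le (hD : D.HasDefiniteWeights)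
    (hP : P.PosSemidef) (hRic : D.IsRiccatiSolution P) {c : ℝ}
    (hS : D.IsStrictStorageMatrix S c) (x : Fin n → ℝ) :
    quadForm (P + S) (D.closedLoopMatrix P *ᵥ x) + c * sqNorm x ≤ quadForm (P + S) x := by
  have hbellman := bellman_eq (A := D.A) (B := D.B) (Q := D.Q₁ + D.Q₂) hD.posDef_control hP x
    (D.gain P *ᵥ x)
  have hfixed : riccatiMap D.A D.B (D.Q₁ + D.Q₂) (D.R₁ + D.R₂) P = P := hRic.symm
  have hgain : riccatiGain D.A D.B (D.R₁ + D.R₂) P = D.gain P := rfl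
  rw [hfixed, hgain, sub_self, quadForm_zero, add_zero] at hbellman
  simp only [quadForm_add_matrix, closedLoopMatrix_mulVec] at hbellman ⊢
  linarith [hS x (D.gain P *ᵥ x), quadForm_nonneg hD.posSemidef_Q₂ x,
    quadForm_nonneg hD.posSemidef_R₂ (D.gain P *ᵥ x)]

theorem continuous_feedback (P : Matrix (Fin n) (Fin n) ℝ) (xe : Fin n → ℝ) (ue : Fin l → ℝ) :
    Continuous (D.feedback P xe ue) := by
  unfold feedback
  fun_prop

theorem measurable_f {α : Type*} [MeasurableSpace α] {x : α → Fin n → ℝ} {u : α → Fin l → ℝ}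
    {w : α → Fin m → ℝ} (hx : Measurable x) (hu : Measurable u) (hw : Measurable w) :
    Measurable fun a => D.f (x a) (u a) (w a) := by
  have hmulVec {d : ℕ} (M : Matrix (Fin n) (Fin d) ℝ) : Measurable fun y => M *ᵥ y :=
    Continuous.measurable (by fun_prop)
  exact ((((hmulVec D.A).comp hx).add ((hmulVec D.B).comp hu)).add
    ((hmulVec D.E).comp hw)).add_const D.z

theorem measurable_closedLoop_step {π : (Fin n → ℝ) → Fin l → ℝ} (hπ : Measurable π) :
    Measurable fun q : (Fin n → ℝ) × (Fin m → ℝ) => D.f q.1 (π q.1) q.2 :=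
  D.measurable_f measurable_fst (hπ.comp measurable_fst) measurable_snd

theorem exists_isInvariant {ρW : Measure (Fin m → ℝ)} [IsProbabilityMeasure ρW]
    (hρW : MemLp id 2 ρW)
    (hP : Summable fun j =>
      ‖(LinearMap.toContinuousLinearMap (D.closedLoopMatrix P).mulVecLin) ^ j‖)
    (xe : Fin n → ℝ) (ue : Fin l → ℝ) :
    ∃ ρ : Measure (Fin n → ℝ), IsP2 ρ ∧ D.IsInvariant (D.feedback P xe ue) ρW ρ := by
  have hnoise : MemLp (fun w => D.f 0 (D.feedback P xe ue 0) w) 2 ρW :=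
    D.memLp_f (memLp_const _) (memLp_const _) hρW
  have hmeas : Measurable fun w => D.f 0 (D.feedback P xe ue 0) w :=
    D.measurable_f measurable_const measurable_const measurable_id
  have := Measure.isProbabilityMeasure_map hmeas.aemeasurable (μ := ρW)
  obtain ⟨ρ, hρ, hρ_memLp, hinv⟩ := exists_invariant_law_of_summable_norm_pow hP
    ((memLp_map_measure_iff aestronglyMeasurable_id hmeas.aemeasurable).2 hnoise)
  refine ⟨ρ, isP2_iff_memLp.2 ⟨hρ, hρ_memLp⟩, Eq.trans ?_ hinv⟩
  have hmap : (ρ.prod ρW).map (Prod.map id fun w => D.f 0 (D.feedback P xe ue 0) w)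
      = ρ.prod (ρW.map fun w => D.f 0 (D.feedback P xe ue 0) w) := by
    rw [← Measure.map_prod_map ρ ρW measurable_id hmeas, Measure.map_id]
  rw [← hmap, Measure.map_map (by fun_prop) (measurable_id.prodMap hmeas)]
  refine congrArg (Measure.map · (ρ.prod ρW)) (funext fun q => ?_)
  exact D.f_feedback P xe ue q.1 q.2

section Mean

variable {Ω : Type*} [MeasurableSpace Ω] {μ : Measure Ω} [IsProbabilityMeasure μ]
  {X : Ω → Fin n → ℝ}

theorem integrable_feedback (P : Matrix (Fin n) (Fin n) ℝ) (xe : Fin n → ℝ) (ue : Fin l → ℝ)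
    (hX : Integrable X μ) : Integrable (fun ω => D.feedback P xe ue (X ω)) μ :=
  ((LinearMap.toContinuousLinearMap (D.gain P).mulVecLin).integrable_comp
    (hX.sub (integrable_const xe))).add (integrable_const ue)

theorem memLp_feedback (P : Matrix (Fin n) (Fin n) ℝ) (xe : Fin n → ℝ) (ue : Fin l → ℝ)
    (hX : MemLp X 2 μ) : MemLp (fun ω => D.feedback P xe ue (X ω)) 2 μ :=
  (memLp_mulVec _ (hX.sub (memLp_const xe))).add (memLp_const ue)

theorem integral_feedback (P : Matrix (Fin n) (Fin n) ℝ) (xe : Fin n → ℝ) (ue : Fin l → ℝ)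
    (hX : Integrable X μ) :
    ∫ ω, D.feedback P xe ue (X ω) ∂μ = D.feedback P xe ue (∫ ω, X ω ∂μ) := by
  have hdev : Integrable (fun ω => X ω - xe) μ := hX.sub (integrable_const xe)
  have hgain : Integrable (fun ω => D.gain P *ᵥ (X ω - xe)) μ :=
    (LinearMap.toContinuousLinearMap (D.gain P).mulVecLin).integrable_comp hdev
  simp only [feedback]
  rw [integral_add hgain (integrable_const _), integral_mulVec _ hdev,
    integral_sub hX (integrable_const _)]
  simp only [integral_const, probReal_univ, one_smul]

variable {D} in
theorem IsInvariant.integral_eq {ρ : Measure (Fin n → ℝ)} {ρW : Measure (Fin m → ℝ)}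
    [IsProbabilityMeasure ρ] [IsProbabilityMeasure ρW]
    (hinv : D.IsInvariant (D.feedback P xe ue) ρW ρ) (hρ : Integrable id ρ)
    (hρW : Integrable id ρW) (hsteady : D.f xe ue (∫ w, w ∂ρW) = xe)
    (hfixed : ∀ y, D.closedLoopMatrix P *ᵥ y = y → y = 0) : ∫ x, x ∂ρ = xe := by
  have hstate : Integrable (fun q : (Fin n → ℝ) × (Fin m → ℝ) => q.1) (ρ.prod ρW) :=
    hρ.comp_fst ρW
  have hnoise : Integrable (fun q : (Fin n → ℝ) × (Fin m → ℝ) => q.2) (ρ.prod ρW) :=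
    hρW.comp_snd ρ
  have hstep := D.measurable_closedLoop_step (D.continuous_feedback P xe ue).measurable
  have hmean : ∫ x, x ∂ρ = D.f (∫ x, x ∂ρ) (D.feedback P xe ue (∫ x, x ∂ρ)) (∫ w, w ∂ρW) := by
    conv_lhs => rw [← hinv]
    rw [integral_map hstep.aemeasurable (f := fun x => x) aestronglyMeasurable_id,
      D.integral_f hstate (D.integrable_feedback P xe ue hstate) hnoise,
      D.integral_feedback P xe ue hstate, integral_fun_fst (fun x => x),
      integral_fun_snd (fun w => w)]
    simp only [probReal_univ, one_smul]
  rw [f_eq_linearStep_add hsteady, sub_self, linearStep, Matrix.mulVec_zero, add_zero, feedback,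
    add_sub_cancel_right, ← closedLoopMatrix_mulVec] at hmean
  exact sub_eq_zero.1 (hfixed _ (sub_eq_iff_eq_add.2 hmean).symm)

end Mean

theorem closedLoop_succ_eq_comp {Ω : Type*} (W : ℕ → Ω → Fin m → ℝ) (π : (Fin n → ℝ) → Fin l → ℝ)
    (X₀ : Ω → Fin n → ℝ) (k : ℕ) :
    D.closedLoop W π X₀ (k + 1) = (fun q : (Fin n → ℝ) × (Fin m → ℝ) => D.f q.1 (π q.1) q.2) ∘
      fun ω => (D.closedLoop W π X₀ k ω, W k ω) :=
  rfl

section Trajectories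

variable {Ω : Type*} [MeasurableSpace Ω] {μ : Measure Ω} {W : ℕ → Ω → Fin m → ℝ}
  {π : (Fin n → ℝ) → Fin l → ℝ} {X₀ : Ω → Fin n → ℝ} {ρ : Measure (Fin n → ℝ)}
  {ρW : Measure (Fin m → ℝ)}

variable {D} in
theorem IsInvariant.hasLaw_closedLoop [IsProbabilityMeasure μ] (hρ : D.IsInvariant π ρW ρ)
    (hπ : Measurable π) (hW : ∀ k, HasLaw (W k) ρW μ) (hX₀ : HasLaw X₀ ρ μ)
    (hind : ∀ k, IndepFun (W k) (D.closedLoop W π X₀ k) μ) (k : ℕ) :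
    HasLaw (D.closedLoop W π X₀ k) ρ μ := by
  have hstep := D.measurable_closedLoop_step hπ
  induction k with
  | zero => exact hX₀
  | succ k ih => exact HasLaw.comp ⟨hstep.aemeasurable, hρ⟩ ((hind k).symm.hasLaw_prod ih (hW k))

theorem indepFun_closedLoop_noise_tail [IsProbabilityMeasure μ] (hπ : Measurable π)
    (hW : ∀ k, Measurable (W k)) (hW_indep : iIndepFun W μ) (hX₀ : AEMeasurable X₀ μ)
    (hX₀W : IndepFun X₀ (fun ω k => W k ω) μ) (k : ℕ) :
    AEMeasurable (D.closedLoop W π X₀ k) μ ∧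
      IndepFun (D.closedLoop W π X₀ k) (fun ω j => W (j + k) ω) μ := by
  have hstep := D.measurable_closedLoop_step hπ
  induction k with
  | zero => exact ⟨hX₀, hX₀W⟩
  | succ k ih =>
    obtain ⟨hmeas, hind⟩ := ih
    have htail : Measurable fun ω j => W (j + (k + 1)) ω := measurable_pi_lambda _ fun j => hW _
    have hsplit : IndepFun (D.closedLoop W π X₀ k) (fun ω => (W k ω, fun j => W (j + (k + 1)) ω))
        μ := by
      have := hind.comp measurable_id
        (ψ := fun v : ℕ → Fin m → ℝ => (v 0, fun j => v (j + 1))) (by fun_prop)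
      simpa only [Function.comp_def, id, zero_add, add_assoc, add_comm 1 k] using this
    have hpair := indepFun_prodMk_of_indepFun hmeas (hW k).aemeasurable htail.aemeasurable hsplit
      (indepFun_tail_of_iIndepFun hW_indep hW k)
    rw [closedLoop_succ_eq_comp]
    exact ⟨hstep.comp_aemeasurable (hmeas.prodMk (hW k).aemeasurable),
      hpair.comp hstep measurable_id⟩

theorem indepFun_noise_closedLoop [IsProbabilityMeasure μ] (hπ : Measurable π)
    (hW : ∀ k, Measurable (W k)) (hW_indep : iIndepFun W μ) (hX₀ : AEMeasurable X₀ μ)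
    (hX₀W : IndepFun X₀ (fun ω k => W k ω) μ) (k : ℕ) :
    IndepFun (W k) (D.closedLoop W π X₀ k) μ := by
  have htail := (D.indepFun_closedLoop_noise_tail hπ hW hW_indep hX₀ hX₀W k).2
  have hcurrent := htail.symm.comp (measurable_pi_apply 0) measurable_id
  simpa only [Function.comp_def, id, zero_add] using hcurrent

theorem isStationaryPair_closedLoop (hπ : Measurable π) (hρ : IsP2 ρ) (hπρ : MemLp π 2 ρ)
    (hlaw : ∀ k, HasLaw (D.closedLoop W π X₀ k) ρ μ)
    (hind : ∀ k, IndepFun (W k) (D.closedLoop W π X₀ k) μ) :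
    D.IsStationaryPair μ W (D.closedLoop W π X₀) (fun k ω => π (D.closedLoop W π X₀ k ω)) := by
  have := hρ.1
  have hcontrol : IsP2 (ρ.map π) := isP2_map hπρ
  have hlaw_control (k : ℕ) : HasLaw (fun ω => π (D.closedLoop W π X₀ k ω)) (ρ.map π) μ :=
    HasLaw.comp ⟨hπ.aemeasurable, rfl⟩ (hlaw k)
  have hcomap_le (k : ℕ) : MeasurableSpace.comap (D.closedLoop W π X₀ k) inferInstance
      ≤ pastSigma (D.closedLoop W π X₀) k :=
    le_iSup₂ (f := fun j (_ : j ∈ Finset.range (k + 1)) =>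
      MeasurableSpace.comap (D.closedLoop W π X₀ j) inferInstance) k (Finset.self_mem_range_succ k)
  exact
    { causal := fun k =>
        { memLp := memLp_of_hasLaw hcontrol (hlaw_control k)
          adapted := ((hπ.comp (comap_measurable _)).stronglyMeasurable.mono
            (hcomap_le k)).aestronglyMeasurable
          indep_state := hind k
          indep_control := (hind k).comp measurable_id hπ }
      law_state := ⟨ρ, hρ, hlaw⟩
      law_control := ⟨ρ.map π, hcontrol, hlaw_control⟩
      dynamics := fun _ _ => rfl }

end Trajectories

end LQData

end ClosedLoop

section Turnpike

theorem isKInfty_const_mul {c : ℝ} (hc : 0 < c) : IsKInfty fun r => c * r where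
  continuousOn := by fun_prop
  strictMonoOn := fun _ _ _ _ hab => mul_lt_mul_of_pos_left hab hc
  map_zero := mul_zero c
  tendsto_atTop := tendsto_id.const_mul_atTop hc

theorem IsKInfty.nonneg {α : ℝ → ℝ} (hα : IsKInfty α) {r : ℝ} (hr : 0 ≤ r) : 0 ≤ α r :=
  hα.map_zero ▸ hα.strictMonoOn.monotoneOn Set.self_mem_Ici hr hr

theorem IsKInfty.pos {α : ℝ → ℝ} (hα : IsKInfty α) {r : ℝ} (hr : 0 < r) : 0 < α r :=
  hα.map_zero ▸ hα.strictMonoOn Set.self_mem_Ici hr.le hr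

theorem card_sub_div_le_card_filter {ι : Type*} {α : ℝ → ℝ} (hα : IsKInfty α) {s : Finset ι}
    {a : ι → ℝ} (ha : ∀ i, 0 ≤ a i) {b : ℝ} (hsum : ∑ i ∈ s, α (a i) ≤ b) {ε : ℝ}
    (hε : 0 < ε) : (s.card : ℝ) - b / α ε ≤ (s.filter fun i => a i ≤ ε).card := by
  have hcard : ((s.filter fun i => a i ≤ ε).card : ℝ) + (s.filter fun i => ¬ a i ≤ ε).card
      = s.card := mod_cast Finset.card_filter_add_card_filter_not _
  have hbad : ((s.filter fun i => ¬ a i ≤ ε).card : ℝ) * α ε ≤ b :=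
    calc ((s.filter fun i => ¬ a i ≤ ε).card : ℝ) * α ε
        = ∑ _i ∈ s.filter fun i => ¬ a i ≤ ε, α ε := by rw [Finset.sum_const, nsmul_eq_mul]
      _ ≤ ∑ i ∈ s.filter fun i => ¬ a i ≤ ε, α (a i) := Finset.sum_le_sum fun i hi =>
          hα.strictMonoOn.monotoneOn hε.le (ha i) (not_le.1 (Finset.mem_filter.1 hi).2).le
      _ ≤ ∑ i ∈ s, α (a i) := Finset.sum_le_sum_of_subset_of_nonneg (Finset.filter_subset _ _)
          fun i _ _ => hα.nonneg (ha i)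
      _ ≤ b := hsum
  linarith [(le_div_iff₀ (hα.pos hε)).2 hbad]

namespace LQData

variable {n l m : ℕ} {D : LQData n l m} {Ω : Type*} [MeasurableSpace Ω] {μ : Measure Ω}
  {W : ℕ → Ω → Fin m → ℝ} {X₀ : Ω → Fin n → ℝ} {U : ℕ → Ω → Fin l → ℝ} {N : ℕ}
  {Xs : ℕ → Ω → Fin n → ℝ} {Us : ℕ → Ω → Fin l → ℝ} {lam : ℕ → (Ω → Fin n → ℝ) → ℝ}
  {α : ℝ → ℝ}

theorem IsAdmissible.memLp_traj [IsFiniteMeasure μ] (hU : D.IsAdmissible μ W N X₀ U)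
    (hW : ∀ k, MemLp (W k) 2 μ) (hX₀ : MemLp X₀ 2 μ) {k : ℕ} (hk : k ≤ N) :
    MemLp (D.traj W X₀ U k) 2 μ := by
  induction k with
  | zero => exact hX₀
  | succ k ih => exact D.memLp_f (ih (Nat.le_of_succ_le hk)) (hU k hk).memLp (hW k)

theorem IsStrictlyDissipativeWith.sum_le [IsFiniteMeasure μ]
    (h : D.IsStrictlyDissipativeWith μ W Xs Us lam α) (hW : ∀ k, MemLp (W k) 2 μ)
    (hX₀ : MemLp X₀ 2 μ) (hU : D.IsAdmissible μ W N X₀ U) :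
    ∑ k ∈ Finset.range N, α (∫ ω, sqNorm (D.traj W X₀ U k ω - Xs k ω) ∂μ)
      ≤ D.cost μ W N X₀ U - ∑ k ∈ Finset.range N, D.stageCost μ (Xs k) (Us k)
        + (lam 0 X₀ - lam N (D.traj W X₀ U N)) := by
  have hstep : ∀ k ∈ Finset.range N, α (∫ ω, sqNorm (D.traj W X₀ U k ω - Xs k ω) ∂μ)
      ≤ D.stageCost μ (D.traj W X₀ U k) (U k) - D.stageCost μ (Xs k) (Us k)
        + (lam k (D.traj W X₀ U k) - lam (k + 1) (D.traj W X₀ U (k + 1))) := fun k hk => by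
    have hk := Finset.mem_range.1 hk
    obtain ⟨hUk, -, hindX, hindU⟩ := hU k hk
    rw [← add_sub_assoc]
    exact h.dissipation k _ (U k) (hU.memLp_traj hW hX₀ hk.le) hUk hindX hindU
  refine (Finset.sum_le_sum hstep).trans_eq ?_
  rw [Finset.sum_add_distrib, Finset.sum_sub_distrib,
    Finset.sum_range_sub' fun k => lam k (D.traj W X₀ U k)]
  rfl

theorem IsStrictlyDissipativeWith.hasMeanSquareTurnpike [IsFiniteMeasure μ]
    (h : D.IsStrictlyDissipativeWith μ W Xs Us lam α) (hW : ∀ k, MemLp (W k) 2 μ) :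
    D.HasMeanSquareTurnpike μ W Xs Us α := by
  intro X₀ hX₀
  obtain ⟨M, hM⟩ := h.bddBelow
  refine ⟨lam 0 X₀ - M, fun N δ _ U hU hcost ε hε => ?_⟩
  have hsum := h.sum_le hW hX₀ hU
  have hlam := hM N _ (hU.memLp_traj hW hX₀ le_rfl)
  have hcount := card_sub_div_le_card_filter h.kInfty (ε := ε) (b := δ + (lam 0 X₀ - M))
    (fun k => integral_nonneg fun ω => sqNorm_nonneg (D.traj W X₀ U k ω - Xs k ω))
    (by linarith) hε
  rwa [Finset.card_range] at hcount

end LQData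

end Turnpike

section StrictDissipativity

namespace LQData

variable {n l m : ℕ} {D : LQData n l m} {Ω : Type*} [MeasurableSpace Ω] {μ : Measure Ω}
  {W : ℕ → Ω → Fin m → ℝ} {P S : Matrix (Fin n) (Fin n) ℝ}
  {w : Fin m → ℝ} {p xs xt : Fin n → ℝ} {ue : Fin l → ℝ} {X₀ : Ω → Fin n → ℝ}
  {ρ : Measure (Fin n → ℝ)} {c : ℝ} {Xs : ℕ → Ω → Fin n → ℝ} {X : Ω → Fin n → ℝ}
  {U : Ω → Fin l → ℝ}

theorem integral_quadForm_sub_of_hasLaw (M : Matrix (Fin n) (Fin n) ℝ) (xe : Fin n → ℝ)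
    (hX : HasLaw X ρ μ) :
    ∫ ω, quadForm M (X ω - xe) ∂μ = ∫ x, quadForm M (x - xe) ∂ρ :=
  hX.integral_comp (f := fun x => quadForm M (x - xe))
    (Continuous.aestronglyMeasurable (by unfold quadForm; fun_prop))

variable [IsProbabilityMeasure μ]

theorem IsCentredStep.of_indepFun {V : Ω → Fin m → ℝ} (hX : MemLp X 2 μ) (hU : MemLp U 2 μ)
    (hV : MemLp V 2 μ) (hmean : ∫ ω, V ω ∂μ = w) (hVX : IndepFun V X μ)
    (hVU : IndepFun V U μ) (xe : Fin n → ℝ) (ue : Fin l → ℝ) :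
    IsCentredStep μ (fun ω => X ω - xe) (fun ω => U ω - ue) (fun ω => V ω - w) where
  memLp_state := hX.sub (memLp_const xe)
  memLp_control := hU.sub (memLp_const ue)
  memLp_noise := hV.sub (memLp_const w)
  indep_state := hVX.comp (measurable_id.sub_const w) (measurable_id.sub_const xe)
  indep_control := hVU.comp (measurable_id.sub_const w) (measurable_id.sub_const ue)
  mean_noise := by
    rw [integral_sub (hV.integrable one_le_two) (integrable_const _), hmean, integral_const,
      probReal_univ, one_smul, sub_self]

theorem IsOptimalSteadyState.mul_integral_sqNorm_sub_le {k : ℕ}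
    (he : D.IsOptimalSteadyState w (xt + xs) ue p) (hD : D.HasDefiniteWeights)
    (hP : P.PosSemidef) (hRic : D.IsRiccatiSolution P) (hS : S.IsSymm)
    (hSc : D.IsStrictStorageMatrix S c) (hW : MemLp (W k) 2 μ)
    (hW_mean : ∫ ω, W k ω ∂μ = w) (hXs : MemLp (Xs k) 2 μ)
    (hXs_mean : ∫ ω, Xs k ω ∂μ = xt + xs) (hXs_indep : IndepFun (W k) (Xs k) μ)
    (hXs_succ : Xs (k + 1) =
      fun ω => D.f (Xs k ω) (D.feedback P (xt + xs) ue (Xs k ω)) (W k ω))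
    (hstat : ∫ ω, quadForm P (Xs (k + 1) ω - (xt + xs)) ∂μ
      = ∫ ω, quadForm P (Xs k ω - (xt + xs)) ∂μ)
    (hX : MemLp X 2 μ) (hU : MemLp U 2 μ) (hXW : IndepFun (W k) X μ)
    (hUW : IndepFun (W k) U μ) :
    c * ∫ ω, sqNorm (X ω - Xs k ω) ∂μ
      ≤ D.stageCost μ X U
        - D.stageCost μ (Xs k) (fun ω => D.feedback P (xt + xs) ue (Xs k ω))
        + storage μ P S (p - (2 : ℝ) • (S *ᵥ xt)) xs xt Xs k X
        - storage μ P S (p - (2 : ℝ) • (S *ᵥ xt)) xs xt Xs (k + 1)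
            (fun ω => D.f (X ω) (U ω) (W k ω)) := by
  have hxu := IsCentredStep.of_indepFun hX hU hW hW_mean hXW hUW (xt + xs) ue
  have hfeedback := D.continuous_feedback P (xt + xs) ue
  have hy : IsCentredStep μ (fun ω => Xs k ω - (xt + xs))
      (fun ω => D.gain P *ᵥ (Xs k ω - (xt + xs))) (fun ω => W k ω - w) := by
    simpa only [feedback, add_sub_cancel_right] using IsCentredStep.of_indepFun hXs
      (D.memLp_feedback P (xt + xs) ue hXs) hW hW_mean hXs_indep
      (hXs_indep.comp measurable_id hfeedback.measurable) (xt + xs) ue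
  have hy_mean : ∫ ω, (Xs k ω - (xt + xs)) ∂μ = 0 := by
    rw [integral_sub (hXs.integrable one_le_two) (integrable_const _), hXs_mean, integral_const,
      probReal_univ, one_smul, sub_self]
  have hsucc : Xs (k + 1) = fun ω => D.linearStep (Xs k ω - (xt + xs))
      (D.gain P *ᵥ (Xs k ω - (xt + xs))) (W k ω - w) + (xt + xs) := by
    simpa only [f_eq_linearStep_add he.steady, feedback, add_sub_cancel_right] using hXs_succ
  have hbalance := he.dissipation_eq (k := k) (Xs := Xs) hD hP hRic hS hxu hy hy_mean
    (by simpa only [hsucc, add_sub_cancel_right] using hstat)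
    (by simp only [sub_add_cancel]) hsucc
  have hsupply := hD.mul_integral_sqNorm_le hSc
    (hxu.memLp_state.sub hy.memLp_state) (hxu.memLp_control.sub hy.memLp_control)
  simp only [Pi.sub_apply] at hsupply
  rw [← hbalance] at hsupply
  simpa only [feedback, sub_sub_sub_cancel_right, sub_add_cancel,
    ← f_eq_linearStep_add he.steady] using hsupply

theorem HasDefiniteWeights.eq_zero_of_closedLoopMatrix_mulVec_eq (hD : D.HasDefiniteWeights)
    (hP : P.PosSemidef) (hRic : D.IsRiccatiSolution P) (hc : 0 < c)
    (hS : D.IsStrictStorageMatrix S c) {y : Fin n → ℝ}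
    (hy : D.closedLoopMatrix P *ᵥ y = y) : y = 0 := by
  by_contra hy_ne
  have hdecrease := hD.quadForm_closedLoopMatrix_le hP hRic hS y
  rw [hy] at hdecrease
  linarith [mul_pos hc (sqNorm_pos hy_ne)]

theorem IsOptimalSteadyState.isStrictlyDissipativeWith_closedLoop
    (he : D.IsOptimalSteadyState w (xt + xs) ue p) (hD : D.HasDefiniteWeights)
    (hP : P.PosSemidef) (hRic : D.IsRiccatiSolution P) (hS : S.PosDef) (hc : 0 < c)
    (hSc : D.IsStrictStorageMatrix S c) (hW : ∀ k, MemLp (W k) 2 μ)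
    (hW_mean : ∀ k, ∫ ω, W k ω ∂μ = w) (hρ : IsP2 ρ) (hρ_mean : ∫ x, x ∂ρ = xt + xs)
    (hlaw : ∀ k, HasLaw (D.closedLoop W (D.feedback P (xt + xs) ue) X₀ k) ρ μ)
    (hind : ∀ k, IndepFun (W k) (D.closedLoop W (D.feedback P (xt + xs) ue) X₀ k) μ) :
    D.IsStrictlyDissipativeWith μ W (D.closedLoop W (D.feedback P (xt + xs) ue) X₀)
      (fun k ω => D.feedback P (xt + xs) ue (D.closedLoop W (D.feedback P (xt + xs) ue) X₀ k ω))
      (storage μ P S (p - (2 : ℝ) • (S *ᵥ xt)) xs xt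
        (D.closedLoop W (D.feedback P (xt + xs) ue) X₀)) fun r => c * r where
  kInfty := isKInfty_const_mul hc
  bddBelow := exists_le_storage (isSymm_of_posSemidef hP) hS _ xs xt
    (fun k => memLp_of_hasLaw hρ (hlaw k)) fun k M => by
      rw [integral_quadForm_sub_of_hasLaw M _ (hlaw k),
        integral_quadForm_sub_of_hasLaw M _ (hlaw 0)]
  dissipation k _ _ hX hU hXW hUW :=
    he.mul_integral_sqNorm_sub_le hD hP hRic (isSymm_of_posSemidef hS.posSemidef) hSc (hW k)
      (hW_mean k) (memLp_of_hasLaw hρ (hlaw k)) ((hlaw k).integral_eq.trans hρ_mean) (hind k) rfl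
      (by rw [integral_quadForm_sub_of_hasLaw P _ (hlaw (k + 1)),
        integral_quadForm_sub_of_hasLaw P _ (hlaw k)]) hX hU hXW hUW

theorem IsOptimalSteadyState.exists_isInvariant_integral_eq {ρW : Measure (Fin m → ℝ)}
    [IsProbabilityMeasure ρW] {xe : Fin n → ℝ}
    (he : D.IsOptimalSteadyState (∫ w, w ∂ρW) xe ue p) (hD : D.HasDefiniteWeights)
    (hP : P.PosSemidef) (hRic : D.IsRiccatiSolution P) (hS : S.PosDef) (hc : 0 < c)
    (hSc : D.IsStrictStorageMatrix S c) (hρW : MemLp id 2 ρW) :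
    ∃ ρ : Measure (Fin n → ℝ), IsP2 ρ ∧ D.IsInvariant (D.feedback P xe ue) ρW ρ ∧
      ∫ x, x ∂ρ = xe := by
  obtain ⟨ρ, hρ, hinv⟩ := D.exists_isInvariant hρW
    (summable_norm_pow_toContinuousLinearMap (Matrix.PosDef.posSemidef_add hP hS) hc
      (hD.quadForm_closedLoopMatrix_le hP hRic hSc)) xe ue
  have := hρ.1
  exact ⟨ρ, hρ, hinv, hinv.integral_eq ((isP2_iff_memLp.1 hρ).2.integrable one_le_two)
    (hρW.integrable one_le_two) he.steady
    fun _ => hD.eq_zero_of_closedLoopMatrix_mulVec_eq hP hRic hc hSc⟩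

theorem one_sub_mulVec_sub_eq_iff {x : Fin n → ℝ} {u : Fin l → ℝ} :
    (1 - D.A) *ᵥ x - D.B *ᵥ u = D.E *ᵥ w + D.z ↔ D.f x u w = x := by
  rw [f, Matrix.sub_mulVec, Matrix.one_mulVec, sub_sub, sub_eq_iff_eq_add', ← add_assoc, eq_comm]

theorem one_sub_mulVec_sub_eq_zero_iff {x : Fin n → ℝ} {u : Fin l → ℝ} :
    (1 - D.A) *ᵥ x - D.B *ᵥ u = 0 ↔ D.A *ᵥ x + D.B *ᵥ u = x := by
  rw [Matrix.sub_mulVec, Matrix.one_mulVec, sub_sub, sub_eq_zero, eq_comm]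

end LQData

end StrictDissipativity

theorem mainTheorem2 {n l m : ℕ} (D : LQData n l m)
    {Ω : Type*} [MeasurableSpace Ω] (μ : Measure Ω) [IsProbabilityMeasure μ]
    (W : ℕ → Ω → Fin m → ℝ)
    -- standing assumptions on the noise: i.i.d. and square integrable
    (hW_meas : ∀ k, Measurable (W k)) (hW_indep : iIndepFun W μ)
    (hW_ident : ∀ k, IdentDistrib (W k) (W 0) μ μ) (hW_L2 : MemLp (W 0) 2 μ)
    -- standing assumptions on the system and the cost
    (hAB : IsStabilizable D.A D.B)
    (hQ₁ : D.Q₁.PosSemidef) (hQ₂ : D.Q₂.PosSemidef)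
    (hR₁ : D.R₁.PosDef) (hR₂ : D.R₂.PosSemidef)
    -- the mean dynamics have a steady state
    (xs : Fin n → ℝ) (us : Fin l → ℝ)
    (hsteady : (1 - D.A) *ᵥ xs - D.B *ᵥ us = D.E *ᵥ (∫ ω, W 0 ω ∂μ) + D.z)
    (hdetect : IsDetectable D.A (CFC.sqrt D.Q₁)) :
    ∃ (P S : Matrix (Fin n) (Fin n) ℝ) (q xt : Fin n → ℝ) (ut : Fin l → ℝ)
      (ρ : Measure (Fin n → ℝ)) (α : ℝ → ℝ),
      P.PosSemidef ∧ D.IsRiccatiSolution P ∧ S.PosDef ∧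
      (1 - D.A) *ᵥ xt - D.B *ᵥ ut = 0 ∧ IsKInfty α ∧
      IsP2 ρ ∧ D.IsInvariant (D.feedback P (xt + xs) (ut + us)) (μ.map (W 0)) ρ ∧
      (CarriesInitialValues n μ W → ∃ Xs₀ : Ω → Fin n → ℝ, HasLaw Xs₀ ρ μ ∧
        ∀ k, IndepFun (W k) (D.closedLoop W (D.feedback P (xt + xs) (ut + us)) Xs₀ k) μ) ∧
      ∀ Xs₀ : Ω → Fin n → ℝ, HasLaw Xs₀ ρ μ →
        (∀ k, IndepFun (W k) (D.closedLoop W (D.feedback P (xt + xs) (ut + us)) Xs₀ k) μ) →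
        ∀ (Xs : ℕ → Ω → Fin n → ℝ) (Us : ℕ → Ω → Fin l → ℝ),
          Xs = D.closedLoop W (D.feedback P (xt + xs) (ut + us)) Xs₀ →
          Us = (fun k ω => D.feedback P (xt + xs) (ut + us) (Xs k ω)) →
          D.IsStationaryPair μ W Xs Us ∧
          D.IsStrictlyDissipativeWith μ W Xs Us (LQData.storage μ P S q xs xt Xs) α ∧
          D.HasMeanSquareTurnpike μ W Xs Us α := by
  have hD : D.HasDefiniteWeights := ⟨hQ₁, hQ₂, hR₁, hR₂⟩
  have hW (k : ℕ) : MemLp (W k) 2 μ := (hW_ident k).symm.memLp_snd hW_L2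
  have hW_law (k : ℕ) : HasLaw (W k) (μ.map (W 0)) μ :=
    ⟨(hW_meas k).aemeasurable, (hW_ident k).map_eq⟩
  have hW_mean (k : ℕ) : ∫ ω, W k ω ∂μ = ∫ w, w ∂(μ.map (W 0)) := (hW_law k).integral_eq
  have hρW : MemLp id 2 (μ.map (W 0)) :=
    (memLp_map_measure_iff aestronglyMeasurable_id (hW_meas 0).aemeasurable).2 hW_L2
  have := Measure.isProbabilityMeasure_map (hW_meas 0).aemeasurable (μ := μ)
  rw [hW_mean 0, LQData.one_sub_mulVec_sub_eq_iff] at hsteady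
  obtain ⟨P, hP, hRic⟩ := hAB.exists_riccatiMap_eq hD.posSemidef_state hD.posDef_control
  obtain ⟨S, hS, c, hc, hSc⟩ := hdetect.exists_storage_of_sqrt D.B hQ₁ hR₁
  obtain ⟨xt, ut, p, hker, he⟩ := LQData.exists_isOptimalSteadyState hQ₁ hR₁ hdetect hsteady
  obtain ⟨ρ, hρ, hinv, hρ_mean⟩ := he.exists_isInvariant_integral_eq hD hP hRic hS hc hSc hρW
  have hπ := (D.continuous_feedback P (xt + xs) (ut + us)).measurable
  refine ⟨P, S, p - (2 : ℝ) • (S *ᵥ xt), xt, ut, ρ, fun r => c * r, hP, hRic, hS,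
    LQData.one_sub_mulVec_sub_eq_zero_iff.2 hker, isKInfty_const_mul hc, hρ, hinv,
    fun hcarries => (hcarries ρ hρ).imp fun X₀ h =>
      ⟨h.1, D.indepFun_noise_closedLoop hπ hW_meas hW_indep h.1.aemeasurable h.2⟩, ?_⟩
  rintro X₀ hX₀ hind _ _ rfl rfl
  have := hρ.1
  have hlaw := hinv.hasLaw_closedLoop hπ hW_law hX₀ hind
  have hdiss := he.isStrictlyDissipativeWith_closedLoop hD hP hRic hS hc hSc hW hW_mean hρ
    hρ_mean hlaw hind
  exact ⟨D.isStationaryPair_closedLoop hπ hρ (D.memLp_feedback P _ _ (isP2_iff_memLp.1 hρ).2)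
    hlaw hind, hdiss, hdiss.hasMeanSquareTurnpike hW⟩
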